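/- **Setting.** Fix a collection $\mathcal L$ of predicate and function symbols, each with an arity in $\mathbb N$. An *$\mathcal L$-structure* $\mathfrak A$ is a complete (possibly empty) metric space $A$ with a continuous map $R^{\mathfrak A}\colon A^n\to\mathbb R$ for each $n$-ary predicate symbol $R$ and a continuous map $f^{\mathfrak A}\colon A^n\to A$ for each $n$-ary function symbol $f$; the distance counts as a binary predicate symbol. Substructures are the topologically closed subsets closed under the functions; $\langle A_0\rangle$ is the smallest substructure containing $A_0$, and $\mathfrak A$ is *finitely generated* if $\mathfrak A=\langle A_0\rangle$ for some finite $A_0$. An *embedding* is an isometric map commuting with all symbols; isomorphisms are the surjective embeddings. A *finite partial isomorphism* $f\colon\mathfrak A\dashrightarrow\mathfrak B$ is a map from a finite set $A_0\subseteq A$ to $B$ that extends to an embedding $\langle A_0\rangle\to\mathfrak B$. The *age* $\mathrm{Age}(\mathfrak A)$ is the class of finitely generated structures that embed in $\mathfrak A$. A separable structure $\mathfrak M$ is *approximately ultra-homogeneous* if for every finite partial isomorphism $\varphi\colon\mathfrak M\dashrightarrow\mathfrak M$ and $\varepsilon>0$ there is an automorphism $f$ of $\mathfrak M$ with $d(\varphi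 a,fa)<\varepsilon$ for all $a\in\mathrm{dom}\,\varphi$. **Approximate isometries.** For metric spaces $X,Y$, let $\mathrm{Apx}(X,Y)$ be the set of $\psi\colon X\times Y\to[0,\infty]$ such that in each argument separately $\psi$ is Katětov, i.e. satisfies $g(x)\le d(x,y)+g(y)$ and $d(x,y)\le g(x)+g(y)$. It has the topology induced from $[0,\infty]^{X\times Y}$ and the pointwise order; $\varphi<\psi$ means that $\varphi$ is in the interior of $\{\rho\in\mathrm{Apx}(X,Y):\rho\le\psi\}$. Composition is $\varphi\psi(x,z)=\inf_y\psi(x,y)+\varphi(y,z)$. A partial isometry $f\colon X\dashrightarrow Y$ is identified with $(x,y)\mapsto\inf_{z\in\mathrm{dom} f}d(x,z)+d(fz,y)$. For $S\subseteq X$, $T\subseteq Y$, the *trivial extension* of $\psi\in\mathrm{Apx}(S,T)$ to $\mathrm{Apx}(X,Y)$ is $(x,y)\mapsto\inf_{s\in S,\,t\in T}d(x,s)+\psi(s,t)+d(t,y)$. For $\varepsilon>0$, $\psi$ is *$\varepsilon$-total* on $A_0\subseteq X$ if for all $x\in A_0$ and $s>\varepsilon$ there is $y\in Y$ with $\psi(x,y)<s$.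 **Classes.** Let $\mathcal K$ be a class of finitely generated $\mathcal L$-structures. A *$\mathcal K$-structure* is a structure $\mathfrak A$ with $\mathrm{Age}(\mathfrak A)\subseteq\mathcal K$. For structures $\mathfrak A,\mathfrak B$, let $\mathrm{Apx}_{2}(\mathfrak A,\mathfrak B)$ be the set of compositions $fg$ of finite partial isomorphisms $g\colon\mathfrak A\dashrightarrow\mathfrak C$, $f\colon\mathfrak C\dashrightarrow\mathfrak B$ with $\mathfrak C\in\mathcal K$; let $\mathrm{Apx}_{\mathcal K}(\mathfrak A,\mathfrak B)$ be the closure in $\mathrm{Apx}(A,B)$ of $\{\psi:\psi\ge\varphi\text{ for some }\varphi\in\mathrm{Apx}_2(\mathfrak A,\mathfrak B)\}$; and let $\mathrm{Stx}(\mathfrak A,\mathfrak B)$ be the set of $\psi\in\mathrm{Apx}_{\mathcal K}(\mathfrak A,\mathfrak B)$ such that $\varphi<\psi$ for some $\varphi\in\mathrm{Apx}_{\mathcal K}(\mathfrak A,\mathfrak B)$. Let $\mathcal K_n$ be the class of pairs $(\bar a,\mathfrak A)$ with $\mathfrak A\in\mathcal K$ and $\bar a\in A^n$ generating $\mathfrak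 A=\langle\bar a\rangle$, and put $d^{\mathcal K}(\bar a,\bar b)=\inf_\psi\max_i\psi(a_i,b_i)$, where $\psi$ ranges over the members of $\mathrm{Stx}(\langle\bar a\rangle,\langle\bar b\rangle)$ that are trivial extensions of approximate isometries between $\{a_i\}$ and $\{b_i\}$. $\mathcal K$ is a *Fraïssé class* if it satisfies: - HP: every member of $\mathcal K$ is a $\mathcal K$-structure. - JEP: any two members of $\mathcal K$ embed in a third one. - NAP: for $\mathfrak A,\mathfrak B\in\mathcal K$, a finite partial isomorphism $f\colon\mathfrak A\dashrightarrow\mathfrak B$ and $\varepsilon>0$ there are $\mathfrak C\in\mathcal K$ and embeddings $g\colon\mathfrak A\to\mathfrak C$, $h\colon\mathfrak B\to\mathfrak C$ with $d(ga,hfa)\le\varepsilon$ for all $a\in\mathrm{dom} f$. - Polish property: $d^{\mathcal K}$ is separable and complete on $\mathcal K_n$ for each $n$. - Continuity property: for each $n$-ary predicate symbol $P$ the map $\mathcal K_n\to\mathbb R$, $\bar a\mapsto P^{\langle\bar a\rangle}(\bar a)$, is continuous, and for each $n$-ary function symbol $f$ and each $m$ the map $\mathcal K_{n+m}\to\mathcal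 K_{n+m+1}$, $(\bar a,\bar b)\mapsto(\bar a,\bar b,f^{\langle\bar a,\bar b\rangle}(\bar a))$, is continuous. A *limit* of $\mathcal K$ is a separable $\mathcal K$-structure $\mathfrak M$ such that for every $\mathcal K$-structure $\mathfrak A$, finite $A_0\subseteq A$, $\psi\in\mathrm{Stx}(\mathfrak A,\mathfrak M)$ and $\varepsilon>0$ there is $\varphi\in\mathrm{Stx}(\mathfrak A,\mathfrak M)$ with $\varphi<\psi$ that is $\varepsilon$-total on $A_0$. **Theorem.** Let $\mathcal K$ be a non-empty class of finitely generated $\mathcal L$-structures. Then the following are equivalent: 1. $\mathcal K$ is a Fraïssé class. 2. $\mathcal K$ is the age of a separable approximately ultra-homogeneous structure. Moreover, every separable approximately ultra-homogeneous structure $\mathfrak M$ with $\mathrm{Age}(\mathfrak M)=\mathcal K$ is a limit of $\mathcal K$. It is unique up to isomorphism: it is isomorphic to every separable approximately ultra-homogeneous structure with age $\mathcal K$, and to every limit of $\mathcal K$. It is universal for separable $\mathcal K$-structures: every separable $\mathcal K$-structure embeds in $\mathfrak M$. -/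

import Mathlib

open scoped ENNReal Topology

universe u v w

/-! ### Approximate isometries -/

/-- A Katetov function with values in `[0, ∞]`. -/
def IsKatetov {X : Type*} [MetricSpace X] (ψ : X → ℝ≥0∞) : Prop :=
  ∀ x y, ψ x ≤ edist x y + ψ y ∧ edist x y ≤ ψ x + ψ y

/-- Approximate isometries from `X` to `Y`: functions `X × Y → [0, ∞]` that are separately Katetov
in each argument. -/
def Apx (X Y : Type*) [MetricSpace X] [MetricSpace Y] : Type _ :=
  {ψ : X → Y → ℝ≥0∞ // (∀ y, IsKatetov fun x => ψ x y) ∧ ∀ x, IsKatetov fun y => ψ x y}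

namespace Apx

variable {X Y Z : Type*} [MetricSpace X] [MetricSpace Y] [MetricSpace Z]

instance : CoeFun (Apx X Y) fun _ => X → Y → ℝ≥0∞ := ⟨Subtype.val⟩

/-- The topology induced by the product topology on `[0, ∞] ^ (X × Y)`. -/
instance : TopologicalSpace (Apx X Y) :=
  TopologicalSpace.induced (Subtype.val : Apx X Y → X → Y → ℝ≥0∞) inferInstance

/-- Pointwise comparison. -/
instance : LE (Apx X Y) := ⟨fun φ ψ => ∀ x y, φ x y ≤ ψ x y⟩

/-- `φ` strictly refines `ψ`: it lies in the interior, inside `Apx X Y`, of the set of refinements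
of `ψ`. -/
def StrictlyRefines (φ ψ : Apx X Y) : Prop := φ ∈ interior {ρ : Apx X Y | ρ ≤ ψ}

/-- Closure under coarsening. -/
def coarsenings (𝒜 : Set (Apx X Y)) : Set (Apx X Y) := {ψ | ∃ φ ∈ 𝒜, φ ≤ ψ}

/-- The pseudo-inverse. -/
def inv (ψ : Apx X Y) : Apx Y X := ⟨fun y x => ψ x y, ψ.2.2, ψ.2.1⟩

/-- The composition `(φψ)(x, z) = inf_y ψ(x, y) + φ(y, z)`. -/
noncomputable def comp (φ : Apx Y Z) (ψ : Apx X Y) : Apx X Z :=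
  ⟨fun x z => ⨅ y, ψ x y + φ y z, by
    refine ⟨fun z x x' => ⟨?_, ?_⟩, fun x z z' => ⟨?_, ?_⟩⟩
    · rw [ENNReal.add_iInf]
      refine le_iInf fun y => (iInf_le _ y).trans ?_
      rw [← add_assoc]
      exact add_le_add_left (ψ.2.1 y x x').1 _
    · rw [ENNReal.iInf_add]
      refine le_iInf fun y => ?_
      rw [ENNReal.add_iInf]
      refine le_iInf fun y' => ?_
      calc edist x x' ≤ ψ x y + ψ x' y := (ψ.2.1 y x x').2
        _ ≤ ψ x y + (edist y y' + ψ x' y') := by gcongr; exact (ψ.2.2 x' y y').1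
        _ ≤ ψ x y + ((φ y z + φ y' z) + ψ x' y') := by gcongr; exact (φ.2.1 z y y').2
        _ = ψ x y + φ y z + (ψ x' y' + φ y' z) := by ring
    · rw [ENNReal.add_iInf]
      refine le_iInf fun y => (iInf_le _ y).trans ?_
      rw [add_left_comm]
      gcongr
      exact (φ.2.2 y z z').1
    · rw [ENNReal.iInf_add]
      refine le_iInf fun y => ?_
      rw [ENNReal.add_iInf]
      refine le_iInf fun y' => ?_
      calc edist z z' ≤ φ y z + φ y z' := (φ.2.2 y z z').2
        _ ≤ φ y z + (edist y y' + φ y' z') := by gcongr; exact (φ.2.1 z' y y').1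
        _ ≤ φ y z + ((ψ x y + ψ x y') + φ y' z') := by gcongr; exact (ψ.2.2 x y y').2
        _ = ψ x y + φ y z + (ψ x y' + φ y' z') := by ring⟩

/-- An isometry `f`, viewed as the approximate isometry `(x, y) ↦ d(f x, y)`. -/
noncomputable def ofIsometry (f : X → Y) (hf : Isometry f) : Apx X Y :=
  ⟨fun x y => edist (f x) y, by
    refine ⟨fun y x x' => ⟨?_, ?_⟩, fun x y y' => ⟨?_, ?_⟩⟩
    · rw [← hf.edist_eq x x']; exact edist_triangle _ _ _
    · rw [← hf.edist_eq x x']; exact edist_triangle_right _ _ _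
    · rw [add_comm]; exact edist_triangle_right _ _ _
    · exact edist_triangle_left _ _ _⟩

/-- The trivial extension `j ψ i*` of `ψ : Apx S T` to `X` and `Y`, where `i` and `j` are the
inclusions of `S` in `X` and of `T` in `Y`. -/
noncomputable def trivialExtension {S : Set X} {T : Set Y} (ψ : Apx S T) : Apx X Y :=
  ((ofIsometry ((↑) : T → Y) isometry_subtype_coe).comp ψ).comp
    (ofIsometry ((↑) : S → X) isometry_subtype_coe).inv

/-- The approximate isometry of a partial isometry `f` defined on `S`,
`(x, y) ↦ inf_{z ∈ S} d(x, z) + d(f z, y)`, as the composition `f i*`, where `i` is the inclusion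
of `S` in `X`. -/
noncomputable def ofPartialIsometry {S : Set X} (f : S → Y) (hf : Isometry f) : Apx X Y :=
  (ofIsometry f hf).comp (ofIsometry ((↑) : S → X) isometry_subtype_coe).inv

/-- `ψ` is `r`-total on the set `S`. -/
def IsTotalOn (ψ : Apx X Y) (r : ℝ≥0∞) (S : Set X) : Prop :=
  ∀ x ∈ S, ∀ s, r < s → ∃ y, ψ x y < s

end Apx

/-! ### Metric structures -/

/-- A metric structure in the signature `L`: a complete metric space (possibly empty) with
continuous real-valued predicates and continuous functions. The symbols of `L.Relations n` are the
`n`-ary predicate symbols. -/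
structure MetricStructure (L : FirstOrder.Language.{v, w}) where
  carrier : Type u
  [metric : MetricSpace carrier]
  [complete : CompleteSpace carrier]
  pred : ∀ {n : ℕ}, L.Relations n → (Fin n → carrier) → ℝ
  func : ∀ {n : ℕ}, L.Functions n → (Fin n → carrier) → carrier
  continuous_pred : ∀ {n : ℕ} (R : L.Relations n), Continuous (pred R)
  continuous_func : ∀ {n : ℕ} (f : L.Functions n), Continuous (func f)

namespace MetricStructure

variable {L : FirstOrder.Language.{v, w}}

instance : CoeSort (MetricStructure.{u} L) (Type u) := ⟨carrier⟩

instance (A : MetricStructure.{u} L) : MetricSpace A := A.metric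

instance (A : MetricStructure.{u} L) : CompleteSpace A := A.complete

/-- The (topologically closed) subsets of `A` that are closed under the functions, that is, the
underlying sets of the substructures of `A`. -/
def IsSubstructure (A : MetricStructure.{u} L) (S : Set A) : Prop :=
  IsClosed S ∧ ∀ {n : ℕ} (f : L.Functions n) (x : Fin n → A), (∀ i, x i ∈ S) → A.func f x ∈ S

/-- A substructure, as a structure. -/
def substructure (A : MetricStructure.{u} L) (S : Set A) (hS : A.IsSubstructure S) :
    MetricStructure.{u} L where
  carrier := S
  complete := hS.1.completeSpace_coe
  pred R x := A.pred R fun i => (x i : A)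
  func f x := ⟨A.func f fun i => (x i : A), hS.2 f _ fun i => (x i).2⟩
  continuous_pred R := (A.continuous_pred R).comp (by fun_prop)
  continuous_func f := Continuous.subtype_mk ((A.continuous_func f).comp (by fun_prop)) _

/-- The underlying set of the smallest substructure of `A` that contains `S`. -/
def span (A : MetricStructure.{u} L) (S : Set A) : Set A :=
  ⋂₀ {T | A.IsSubstructure T ∧ S ⊆ T}

theorem subset_span (A : MetricStructure.{u} L) (S : Set A) : S ⊆ A.span S :=
  Set.subset_sInter fun _ hT => hT.2

theorem span_mono (A : MetricStructure.{u} L) {S T : Set A} (h : S ⊆ T) : A.span S ⊆ A.span T :=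
  Set.subset_sInter fun _ hU => Set.sInter_subset_of_mem ⟨hU.1, h.trans hU.2⟩

theorem isSubstructure_span (A : MetricStructure.{u} L) (S : Set A) :
    A.IsSubstructure (A.span S) :=
  ⟨isClosed_sInter fun _ hT => hT.1.1,
    fun f x hx T hT => hT.1.2 f x fun i => Set.mem_sInter.1 (hx i) T hT⟩

/-- The substructure `⟨S⟩` generated by `S`. -/
def generated (A : MetricStructure.{u} L) (S : Set A) : MetricStructure.{u} L :=
  A.substructure (A.span S) (A.isSubstructure_span S)

/-- `A` is finitely generated. -/
def FinitelyGenerated (A : MetricStructure.{u} L) : Prop :=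
  ∃ S : Set A, S.Finite ∧ A.span S = Set.univ

/-- Embeddings of structures. They preserve the distance, which counts as a symbol. -/
structure Embedding (A B : MetricStructure.{u} L) where
  toFun : A → B
  isometry : Isometry toFun
  map_pred : ∀ {n : ℕ} (R : L.Relations n) (x : Fin n → A),
    B.pred R (fun i => toFun (x i)) = A.pred R x
  map_func : ∀ {n : ℕ} (f : L.Functions n) (x : Fin n → A),
    B.func f (fun i => toFun (x i)) = toFun (A.func f x)

instance (A B : MetricStructure.{u} L) : CoeFun (Embedding A B) fun _ => A → B :=
  ⟨Embedding.toFun⟩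

/-- An isomorphism is a surjective embedding (its inverse is an embedding as well). -/
structure Isomorphism (A B : MetricStructure.{u} L) extends Embedding A B where
  surjective : Function.Surjective toFun

/-- A finite partial isomorphism from `A` to `B`: a map from a finite subset of `A` to `B` that
extends to an embedding of the substructure generated by this subset. -/
structure FinitePartialIso (A B : MetricStructure.{u} L) where
  dom : Set A
  finite_dom : dom.Finite
  toFun : dom → B
  extends_embedding : ∃ e : Embedding (A.generated dom) B,
    ∀ a : dom, e ⟨a, A.subset_span dom a.2⟩ = toFun a

theorem FinitePartialIso.isometry {A B : MetricStructure.{u} L} (f : FinitePartialIso A B) :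
    Isometry f.toFun := by
  obtain ⟨e, he⟩ := f.extends_embedding
  intro a b
  rw [← he a, ← he b]
  exact e.isometry _ _

/-- A finite partial isomorphism, viewed as an approximate isometry. -/
noncomputable def FinitePartialIso.toApx {A B : MetricStructure.{u} L}
    (f : FinitePartialIso A B) : Apx A B :=
  Apx.ofPartialIsometry f.toFun f.isometry

/-- `M` is separable, and every finite partial isomorphism from `M` to itself is arbitrarily close
to the restriction of an automorphism. -/
def IsApproximatelyUltrahomogeneous (M : MetricStructure.{u} L) : Prop :=
  TopologicalSpace.SeparableSpace M ∧
    ∀ (φ : FinitePartialIso M M) (ε : ℝ), 0 < ε →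
      ∃ f : Isomorphism M M, ∀ a : φ.dom, dist (φ.toFun a) (f.toEmbedding (a : M)) < ε

/-- The age of `A`: the finitely generated structures that embed in `A`. -/
def age (A : MetricStructure.{u} L) : Set (MetricStructure.{u} L) :=
  {B | B.FinitelyGenerated ∧ Nonempty (Embedding B A)}

/-! ### Classes of finitely generated structures -/

section Classes

variable (K : Set (MetricStructure.{u} L))

/-- `A` is a `K`-structure. -/
def IsStructureOf (A : MetricStructure.{u} L) : Prop := A.age ⊆ K

/-- Hereditary property. -/
def HP : Prop := ∀ A ∈ K, IsStructureOf K A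

/-- Joint embedding property. -/
def JEP : Prop :=
  ∀ A ∈ K, ∀ B ∈ K, ∃ C ∈ K, Nonempty (Embedding A C) ∧ Nonempty (Embedding B C)

/-- Near amalgamation property. -/
def NAP : Prop :=
  ∀ A ∈ K, ∀ B ∈ K, ∀ (f : FinitePartialIso A B) (ε : ℝ), 0 < ε →
    ∃ C ∈ K, ∃ (g : Embedding A C) (h : Embedding B C),
      ∀ a : f.dom, dist (g (a : A)) (h (f.toFun a)) ≤ ε

/-- The compositions of two finite partial isomorphisms through some member of `K`. -/
def apxTwo (A B : MetricStructure.{u} L) : Set (Apx A B) :=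
  {ψ | ∃ C ∈ K, ∃ (g : FinitePartialIso A C) (f : FinitePartialIso C B),
    ψ = f.toApx.comp g.toApx}

/-- The (`K`-intrinsic) approximate isomorphisms from `A` to `B`. -/
def apx (A B : MetricStructure.{u} L) : Set (Apx A B) :=
  closure (Apx.coarsenings (apxTwo K A B))

/-- The strictly approximate isomorphisms from `A` to `B`. -/
def stx (A B : MetricStructure.{u} L) : Set (Apx A B) :=
  {ψ | ψ ∈ apx K A B ∧ ∃ φ ∈ apx K A B, φ.StrictlyRefines ψ}

/-- `K_n`: the members of `K` together with a generating `n`-tuple. -/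
structure Generated (n : ℕ) where
  str : MetricStructure.{u} L
  mem : str ∈ K
  tuple : Fin n → str
  span_eq : str.span (Set.range tuple) = Set.univ

variable {K}

/-- The strictly approximate isomorphisms between the structures generated by two tuples that are
trivial extensions of approximate isometries between the tuples. -/
def Generated.stx {n m : ℕ} (a : Generated K n) (b : Generated K m) : Set (Apx a.str b.str) :=
  {ψ | ψ ∈ MetricStructure.stx K a.str b.str ∧
    ∃ ψ₀ : Apx (Set.range a.tuple) (Set.range b.tuple), ψ = ψ₀.trivialExtension}

/-- The intrinsic pseudo-distance `d^K` on `K_n`. -/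
noncomputable def Generated.distK {n : ℕ} (a b : Generated K n) : ℝ≥0∞ :=
  ⨅ ψ ∈ Generated.stx a b, ⨆ i, ψ (a.tuple i) (b.tuple i)

/-- The tuple `(a, b, f a)` obtained from `(a, b)`, where `f` is an `n`-ary function symbol, `a` is
an `n`-tuple and `b` is an `m`-tuple. -/
def Generated.adjoin {n m : ℕ} (f : L.Functions n) (c : Generated K (n + m)) :
    Generated K (n + m + 1) where
  str := c.str
  mem := c.mem
  tuple := Fin.snoc (α := fun _ => c.str) c.tuple
    (c.str.func f fun i => c.tuple (Fin.castAdd m i))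
  span_eq := by
    refine Set.eq_univ_of_univ_subset (c.span_eq ▸ c.str.span_mono ?_)
    rintro _ ⟨i, rfl⟩
    exact ⟨i.castSucc, Fin.snoc_castSucc (α := fun _ => c.str) _ _ i⟩

variable (K)

/-- Polish property: `d^K` is separable and complete on `K_n` for each `n`. -/
def PP : Prop :=
  ∀ n : ℕ,
    (∃ D : Set (Generated K n), D.Countable ∧
      ∀ (a : Generated K n) (ε : ℝ≥0∞), 0 < ε → ∃ b ∈ D, a.distK b < ε) ∧
    ∀ s : ℕ → Generated K n,
      (∀ ε : ℝ≥0∞, 0 < ε → ∃ N, ∀ i ≥ N, ∀ j ≥ N, (s i).distK (s j) < ε) →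
      ∃ a : Generated K n, ∀ ε : ℝ≥0∞, 0 < ε → ∃ N, ∀ i ≥ N, (s i).distK a < ε

/-- Continuity property: every symbol is continuous on `K`. (The distance is always continuous
on `K_2`.) -/
def CP : Prop :=
  (∀ (n : ℕ) (R : L.Relations n) (a : Generated K n) (ε : ℝ), 0 < ε →
    ∃ δ : ℝ≥0∞, 0 < δ ∧ ∀ b : Generated K n, a.distK b < δ →
      |a.str.pred R a.tuple - b.str.pred R b.tuple| < ε) ∧
  ∀ (n m : ℕ) (f : L.Functions n) (a : Generated K (n + m)) (ε : ℝ≥0∞), 0 < ε →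
    ∃ δ : ℝ≥0∞, 0 < δ ∧ ∀ b : Generated K (n + m), a.distK b < δ →
      (a.adjoin f).distK (b.adjoin f) < ε

/-- Fraïssé classes, among the classes of finitely generated structures. -/
structure IsFraisseClass : Prop where
  finitelyGenerated : ∀ A ∈ K, A.FinitelyGenerated
  hp : HP K
  jep : JEP K
  nap : NAP K
  pp : PP K
  cp : CP K

/-- `M` is a limit of `K`. -/
def IsFraisseLimit (M : MetricStructure.{u} L) : Prop :=
  TopologicalSpace.SeparableSpace M ∧ IsStructureOf K M ∧
    ∀ A : MetricStructure.{u} L, IsStructureOf K A →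
      ∀ S : Set A, S.Finite → ∀ ψ ∈ stx K A M, ∀ ε : ℝ, 0 < ε →
        ∃ φ ∈ stx K A M, φ.StrictlyRefines ψ ∧ φ.IsTotalOn (ENNReal.ofReal ε) S

end Classes

end MetricStructure

/-!
The proof replaces approximate isometries by joint embeddings. Two finite families of points in
structures whose age lies in `K` are `r`-close (`Close`) if a member of `K` contains copies of both
at distance less than `r` from each other. Under the hereditary and near amalgamation properties,
`d^K(a, b) < r` means exactly that `a` and `b` are `r`-close (`Generated.distK_lt_ofReal_iff`),
because a strictly approximate isomorphism always lies, by a positive margin, above one that is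
induced by nearby copies of two finite families (`exists_of_mem_stx`, `mem_stx_of_iInf_le`), and
near amalgamation extends these copies to any larger finite families. Closeness then satisfies the
triangle inequality, and being a limit of `K` implies the one-point extension property `Rich`: if a
member of `K` contains a copy of a tuple of `M`, then each of its points is approximately realized
over this tuple in `M` (`IsFraisseLimit.rich`).

*From the structure to the class.* If `M` is approximately ultra-homogeneous, then whatever is close
to a tuple `x` of `M` has a copy in `M` near `x`: some copy exists in `M` by the definition of the
age, and an automorphism moves it close to `x`. Amalgamation, completeness and separability of the
spaces of tuples, and continuity of the symbols are thereby read off `M` itself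
(`IsApproximatelyUltrahomogeneous.isFraisseClass_age`), as is the fact that `M` is a limit.

*Types.* In a Fraïssé class, arbitrarily close families have the same type, that is, one is mapped
to the other by an embedding of the substructure that it generates
(`IsFraisseClass.sameType_of_close`). Indeed the continuity property gives each function symbol a
modulus of continuity near the copies of a tuple that does not depend on the ambient structure
(`IsFraisseClass.exists_func_close`); hence the set of pairs of points that are forced to be close
when the two generating families are close is stable under function symbols and limits, and it is
the graph of an embedding.

*Uniqueness and universality.* Between structures with the one-point extension property, finite
correspondences that are `r`-close can be improved to be `δ`-close, for any `δ > 0`, and extended by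
a given point on either side, by moving the points by less than `r`. Iterating with radii
`ε / 2 ^ j` gives dense sequences of the same type in the limit, hence an isomorphism near the given
correspondence (`IsFraisseClass.exists_isomorphism_of_close`). This gives uniqueness and approximate
ultra-homogeneity; the forth half gives universality.

*Existence.* Amalgamating one point at a time along a countable list of requirements produces a
sequence whose finite parts have coherent types in `K` and over which all types are approximately
realized (`GenericSequence`). The limit is the completion of this sequence as a metric space. By the
Polish property each tuple of the completion has a type, realized in a member of `K`; the predicate
and function symbols are defined, and shown to be continuous, by means of these types.
-/

namespace MetricStructure

variable {L : FirstOrder.Language.{v, w}} {A B C D M N : MetricStructure.{u} L}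
variable {K : Set (MetricStructure.{u} L)}

/-! ### Embeddings and generated substructures -/

theorem span_subset {S T : Set A} (hT : A.IsSubstructure T) (h : S ⊆ T) : A.span S ⊆ T :=
  Set.sInter_subset_of_mem ⟨hT, h⟩

namespace Embedding

/-- The identity embedding. -/
def refl (A : MetricStructure.{u} L) : Embedding A A :=
  ⟨id, isometry_id, fun _ _ => rfl, fun _ _ => rfl⟩

/-- The composition of two embeddings, the first one being applied first. -/
def trans (e : Embedding A B) (f : Embedding B C) : Embedding A C where
  toFun x := f (e x)
  isometry := f.isometry.comp e.isometry
  map_pred R x := (f.map_pred R fun i => e (x i)).trans (e.map_pred R x)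
  map_func F x := (f.map_func F fun i => e (x i)).trans (congrArg f (e.map_func F x))

/-- The inclusion of a generated substructure. -/
def incl (A : MetricStructure.{u} L) (S : Set A) : Embedding (A.generated S) A :=
  ⟨Subtype.val, isometry_subtype_coe, fun _ _ => rfl, fun _ _ => rfl⟩

theorem isSubstructure_preimage (e : Embedding A B) {T : Set B} (hT : B.IsSubstructure T) :
    A.IsSubstructure (e ⁻¹' T) := by
  refine ⟨hT.1.preimage e.isometry.continuous, fun f x hx => ?_⟩
  rw [Set.mem_preimage, ← e.map_func f x]
  exact hT.2 f _ hx

theorem isSubstructure_image (e : Embedding A B) {T : Set A} (hT : A.IsSubstructure T) :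
    B.IsSubstructure (e '' T) := by
  refine ⟨e.isometry.isClosedEmbedding.isClosedMap _ hT.1, fun f x hx => ?_⟩
  choose y hy hyx using hx
  refine ⟨A.func f y, hT.2 f y hy, ?_⟩
  rw [← e.map_func f y]
  exact congrArg _ (funext hyx)

theorem isSubstructure_range (e : Embedding A B) : B.IsSubstructure (Set.range e) := by
  rw [← Set.image_univ]
  exact e.isSubstructure_image ⟨isClosed_univ, fun _ _ _ => trivial⟩

/-- An embedding whose range lies in that of `e` factors through `e`. -/
theorem exists_lift (e : Embedding D A) (k : Embedding B A) (h : ∀ x, k x ∈ Set.range e) :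
    ∃ l : Embedding B D, ∀ x, e (l x) = k x := by
  choose l hl using h
  refine ⟨⟨l, fun x y => ?_, fun R x => ?_, fun f x => ?_⟩, hl⟩
  · rw [← e.isometry.edist_eq, hl, hl, k.isometry.edist_eq]
  · rw [← e.map_pred, ← k.map_pred]
    exact congrArg _ (funext fun i => hl _)
  · apply e.isometry.injective
    rw [← e.map_func, hl, ← k.map_func]
    exact congrArg _ (funext fun i => hl _)

theorem mem_of_span_eq_univ (k : Embedding B A) {S : Set B} (hS : B.span S = Set.univ) {T : Set A}
    (hT : A.IsSubstructure T) (h : ∀ x ∈ S, k x ∈ T) (x : B) : k x ∈ T :=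
  span_subset (k.isSubstructure_preimage hT) h (hS ▸ Set.mem_univ x)

theorem eq_of_eqOn (e k : Embedding B A) {S : Set B} (hS : B.span S = Set.univ)
    (h : ∀ x ∈ S, e x = k x) (x : B) : e x = k x := by
  have hT : B.IsSubstructure {x | e x = k x} := by
    refine ⟨isClosed_eq e.isometry.continuous k.isometry.continuous, fun f y hy => ?_⟩
    rw [Set.mem_ofPred_eq, ← e.map_func, ← k.map_func]
    exact congrArg _ (funext hy)
  exact span_subset hT h (hS ▸ Set.mem_univ x)

end Embedding

/-- The substructure generated by a family. -/
abbrev gen {ι : Type*} (A : MetricStructure.{u} L) (a : ι → A) : MetricStructure.{u} L :=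
  A.generated (Set.range a)

/-- The family `a`, as a family in the substructure that it generates. -/
def genTuple {ι : Type*} (a : ι → A) (i : ι) : A.gen a :=
  ⟨a i, A.subset_span _ ⟨i, rfl⟩⟩

theorem span_preimage_generated (S : Set A) :
    (A.generated S).span (Embedding.incl A S ⁻¹' S) = Set.univ := by
  refine Set.eq_univ_of_forall fun x T hT => ?_
  obtain ⟨y, hy, hyx⟩ : x.1 ∈ Embedding.incl A S '' T := by
    refine span_subset ((Embedding.incl A S).isSubstructure_image hT.1) (fun s hs => ?_) x.2
    exact ⟨⟨s, A.subset_span S hs⟩, hT.2 hs, rfl⟩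
  rwa [← Subtype.ext (a1 := y) (a2 := x) hyx]

theorem span_range_genTuple {ι : Type*} (a : ι → A) :
    (A.gen a).span (Set.range (genTuple a)) = Set.univ := by
  rw [← span_preimage_generated]
  congr 1
  ext x
  constructor
  · rintro ⟨i, rfl⟩
    exact ⟨i, rfl⟩
  · rintro ⟨i, hi⟩
    exact ⟨i, Subtype.ext hi⟩

theorem finitelyGenerated_generated {S : Set A} (hS : S.Finite) :
    (A.generated S).FinitelyGenerated :=
  ⟨_, hS.preimage (Embedding.incl A S).isometry.injective.injOn, span_preimage_generated S⟩

/-! ### Families of the same type -/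

/-- Two families, in possibly different structures, have the same (quantifier-free) type: they are
the images of one family under embeddings of a common structure. -/
def SameType {ι : Type*} (a : ι → A) (b : ι → B) : Prop :=
  ∃ (D : MetricStructure.{u} L) (d : ι → D) (f : Embedding D A) (g : Embedding D B),
    (∀ i, f (d i) = a i) ∧ ∀ i, g (d i) = b i

namespace SameType

variable {ι κ : Type*} {a : ι → A} {b : ι → B} {c : ι → C}

theorem refl (a : ι → A) : SameType a a :=
  ⟨A, a, .refl A, .refl A, fun _ => rfl, fun _ => rfl⟩

theorem symm (h : SameType a b) : SameType b a :=
  let ⟨D, d, f, g, hf, hg⟩ := h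
  ⟨D, d, g, f, hg, hf⟩

theorem comp (h : SameType a b) (σ : κ → ι) : SameType (fun k => a (σ k)) (fun k => b (σ k)) :=
  let ⟨D, d, f, g, hf, hg⟩ := h
  ⟨D, fun k => d (σ k), f, g, fun _ => hf _, fun _ => hg _⟩

theorem of_embedding (e : Embedding A B) (a : ι → A) : SameType a (fun i => e (a i)) :=
  ⟨A, a, .refl A, e, fun _ => rfl, fun _ => rfl⟩

/-- If `a` generates `A`, then a family of the same type is the image of `a` under an embedding. -/
theorem exists_embedding (h : SameType a b) (ha : A.span (Set.range a) = Set.univ) :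
    ∃ e : Embedding A B, ∀ i, e (a i) = b i := by
  obtain ⟨D, d, f, g, hf, hg⟩ := h
  obtain ⟨l, hl⟩ := f.exists_lift (.refl A) fun x =>
    (Embedding.refl A).mem_of_span_eq_univ ha f.isSubstructure_range
      (by rintro _ ⟨i, rfl⟩; exact ⟨d i, hf i⟩) x
  refine ⟨l.trans g, fun i => ?_⟩
  rw [← hg i]
  refine congrArg g (f.isometry.injective ?_)
  rw [hl, hf]
  rfl

theorem genTuple_left (a : ι → A) : SameType (genTuple a) a :=
  of_embedding (Embedding.incl A (Set.range a)) (genTuple a)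

theorem exists_gen_embedding (h : SameType a b) :
    ∃ e : Embedding (A.gen a) B, ∀ i, e (genTuple a i) = b i := by
  obtain ⟨D, d, f, g, hf, hg⟩ := h
  obtain ⟨l, hl⟩ := f.exists_lift (.incl A (Set.range a)) fun x =>
    (Embedding.incl A _).mem_of_span_eq_univ (span_range_genTuple a) f.isSubstructure_range
      (by rintro _ ⟨i, rfl⟩; exact ⟨d i, hf i⟩) x
  refine ⟨l.trans g, fun i => ?_⟩
  rw [← hg i]
  refine congrArg g (f.isometry.injective ?_)
  rw [hl, hf]
  rfl

theorem trans (h : SameType a b) (h' : SameType b c) : SameType a c := by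
  obtain ⟨e, he⟩ := h.symm.exists_gen_embedding
  obtain ⟨e', he'⟩ := h'.exists_gen_embedding
  exact ⟨B.gen b, genTuple b, e, e', he, he'⟩

theorem dist_eq (h : SameType a b) (i j : ι) : dist (a i) (a j) = dist (b i) (b j) := by
  obtain ⟨D, d, f, g, hf, hg⟩ := h
  rw [← hf, ← hf, ← hg, ← hg, f.isometry.dist_eq, g.isometry.dist_eq]

theorem pred_eq (h : SameType a b) {n : ℕ} (R : L.Relations n) (σ : Fin n → ι) :
    A.pred R (fun k => a (σ k)) = B.pred R (fun k => b (σ k)) := by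
  obtain ⟨D, d, f, g, hf, hg⟩ := h
  simp only [← hf, ← hg, f.map_pred, g.map_pred]

/-- Adjoining the value of a function symbol preserves equality of types. -/
theorem adjoin_func (h : SameType a b) {n : ℕ} (F : L.Functions n) (σ : Fin n → ι) :
    SameType (Option.elim' (A.func F fun k => a (σ k)) a)
      (Option.elim' (B.func F fun k => b (σ k)) b) := by
  obtain ⟨D, d, f, g, hf, hg⟩ := h
  refine ⟨D, Option.elim' (D.func F fun k => d (σ k)) d, f, g, ?_, ?_⟩
  · rintro (_ | i)
    · simp only [Option.elim'_none, ← hf, f.map_func]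
    · exact hf i
  · rintro (_ | i)
    · simp only [Option.elim'_none, ← hg, g.map_func]
    · exact hg i

theorem span_eq_univ_of_extends {κ : Type*} {a' : κ → A} (ha : A.span (Set.range a) = Set.univ)
    (σ : ι → κ) (h : ∀ i, a' (σ i) = a i) : A.span (Set.range a') = Set.univ := by
  refine Set.eq_univ_of_univ_subset (ha ▸ A.span_mono ?_)
  rintro _ ⟨i, rfl⟩
  exact ⟨σ i, h i⟩

end SameType

/-! ### Structures whose age lies in a class -/

theorem IsStructureOf.generated_mem (hA : IsStructureOf K A) {S : Set A} (hS : S.Finite) :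
    A.generated S ∈ K :=
  hA ⟨finitelyGenerated_generated hS, ⟨Embedding.incl A S⟩⟩

theorem IsStructureOf.gen_mem {ι : Type*} [Finite ι] (hA : IsStructureOf K A) (a : ι → A) :
    A.gen a ∈ K :=
  hA.generated_mem (Set.finite_range a)

theorem IsStructureOf.of_embedding (hB : IsStructureOf K B) (e : Embedding A B) :
    IsStructureOf K A :=
  fun _ hC => hB ⟨hC.1, hC.2.map fun k => k.trans e⟩

/-! ### Joint embeddings of two families -/

theorem FinitePartialIso.sameType (f : FinitePartialIso A B) :
    SameType (fun s : f.dom => (s : A)) f.toFun := by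
  obtain ⟨e, he⟩ := f.extends_embedding
  exact ⟨A.generated f.dom, fun s => ⟨s, A.subset_span f.dom s.2⟩, Embedding.incl A f.dom, e,
    fun _ => rfl, he⟩

/-- Families of the same type are matched by a finite partial isomorphism. Since `a` need not be
injective, its domain is the range of `a`. -/
theorem SameType.exists_finitePartialIso {ι : Type*} [Finite ι] {a : ι → A} {b : ι → B}
    (h : SameType a b) : ∃ f : FinitePartialIso A B, f.dom = Set.range a ∧
      ∀ i (hi : a i ∈ f.dom), f.toFun ⟨a i, hi⟩ = b i := by
  obtain ⟨e, he⟩ := h.exists_gen_embedding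
  exact ⟨⟨Set.range a, Set.finite_range a, fun s => e ⟨s, A.subset_span _ s.2⟩, e, fun _ => rfl⟩,
    rfl, fun i _ => he i⟩

/-- Two families are `r`-close if some member of `K` contains copies of both, at distance less than
`r` from each other. For tuples that generate members of `K`, this says that their `d^K`-distance is
less than `r`. -/
def Close (K : Set (MetricStructure.{u} L)) {ι : Type*} (a : ι → A) (b : ι → B) (r : ℝ) : Prop :=
  ∃ C ∈ K, ∃ c c' : ι → C, SameType a c ∧ SameType b c' ∧ ∀ i, dist (c i) (c' i) < r

theorem exists_lt_of_forall_lt {ι : Type*} [Finite ι] {f : ι → ℝ} {r : ℝ} (h : ∀ i, f i < r) :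
    ∃ s < r, ∀ i, f i < s := by
  cases isEmpty_or_nonempty ι
  · exact ⟨r - 1, by linarith, fun i => isEmptyElim i⟩
  · obtain ⟨i, hi⟩ := Finite.exists_max f
    obtain ⟨s, hs, hsr⟩ := exists_between (h i)
    exact ⟨s, hsr, fun j => (hi j).trans_lt hs⟩

namespace Close

variable {ι κ : Type*} {a : ι → A} {b : ι → B} {c : ι → C} {r s : ℝ}

theorem symm (h : Close K a b r) : Close K b a r :=
  let ⟨C, hC, c, c', hc, hc', hd⟩ := h
  ⟨C, hC, c', c, hc', hc, fun i => dist_comm (c i) (c' i) ▸ hd i⟩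

theorem mono (h : Close K a b r) (hrs : r ≤ s) : Close K a b s :=
  let ⟨C, hC, c, c', hc, hc', hd⟩ := h
  ⟨C, hC, c, c', hc, hc', fun i => (hd i).trans_le hrs⟩

theorem comp (h : Close K a b r) (σ : κ → ι) :
    Close K (fun k => a (σ k)) (fun k => b (σ k)) r :=
  let ⟨C, hC, _, _, hc, hc', hd⟩ := h
  ⟨C, hC, _, _, hc.comp σ, hc'.comp σ, fun _ => hd _⟩

theorem congr_left (h : Close K a b r) (ha : SameType c a) : Close K c b r :=
  let ⟨C, hC, _, _, hc, hc', hd⟩ := h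
  ⟨C, hC, _, _, ha.trans hc, hc', hd⟩

theorem congr_right (h : Close K a b r) (hb : SameType b c) : Close K a c r :=
  (h.symm.congr_left hb.symm).symm

theorem exists_lt [Finite ι] (h : Close K a b r) : ∃ s < r, Close K a b s :=
  let ⟨C, hC, c, c', hc, hc', hd⟩ := h
  let ⟨s, hs, h⟩ := exists_lt_of_forall_lt hd
  ⟨s, hs, C, hC, c, c', hc, hc', h⟩

/-- Families in the same structure. -/
theorem of_dist_lt [Finite ι] (hA : IsStructureOf K A) {a a' : ι → A}
    (h : ∀ i, dist (a i) (a' i) < r) : Close K a a' r := by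
  refine ⟨_, hA.gen_mem (Sum.elim a a'), fun i => genTuple (Sum.elim a a') (.inl i),
    fun i => genTuple (Sum.elim a a') (.inr i), ?_, ?_, h⟩
  · exact (SameType.genTuple_left (Sum.elim a a')).symm.comp Sum.inl
  · exact (SameType.genTuple_left (Sum.elim a a')).symm.comp Sum.inr

theorem of_sameType [Finite ι] (hA : IsStructureOf K A) (h : SameType a b) (hr : 0 < r) :
    Close K a b r :=
  (of_dist_lt hA (a := a) (a' := a) fun i => by simpa using hr).congr_right h

/-- Distances change by less than `2 r` between `r`-close families. -/
theorem dist_lt (h : Close K a b r) (i j : ι) : dist (b i) (b j) < dist (a i) (a j) + 2 * r := by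
  obtain ⟨C, -, c, c', hc, hc', hd⟩ := h
  rw [hc.dist_eq, hc'.dist_eq]
  have h1 := dist_triangle4 (c' i) (c i) (c j) (c' j)
  have h2 := hd i
  have h3 := hd j
  rw [dist_comm] at h2
  linarith

end Close

/-- Near amalgamation, for two families `a` and `b` whose parts `a ∘ σ` and `b ∘ ρ` have the same
type: these parts get close in a joint embedding of the whole families. -/
theorem NAP.exists_amalgam (nap : NAP K) {ι κ τ : Type*} [Finite ι] [Finite κ]
    [Finite τ] (hA : IsStructureOf K A) (hB : IsStructureOf K B) {a : ι → A} {b : κ → B}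
    (σ : τ → ι) (ρ : τ → κ) (h : SameType (fun t => a (σ t)) (fun t => b (ρ t))) {ε : ℝ}
    (hε : 0 < ε) : ∃ E ∈ K, ∃ (a' : ι → E) (b' : κ → E), SameType a a' ∧ SameType b b' ∧
      ∀ t, dist (a' (σ t)) (b' (ρ t)) < ε := by
  have h' : SameType (fun t => genTuple a (σ t)) (fun t => genTuple b (ρ t)) :=
    ((SameType.genTuple_left a).comp σ).trans (h.trans ((SameType.genTuple_left b).symm.comp ρ))
  obtain ⟨f, hf, hf'⟩ := h'.exists_finitePartialIso
  obtain ⟨E, hE, g, k, hd⟩ := nap _ (hA.gen_mem a) _ (hB.gen_mem b) f (ε / 2) (half_pos hε)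
  refine ⟨E, hE, fun i => g (genTuple a i), fun i => k (genTuple b i),
    (SameType.genTuple_left a).symm.trans (.of_embedding _ _),
    (SameType.genTuple_left b).symm.trans (.of_embedding _ _), fun t => ?_⟩
  have ht : genTuple a (σ t) ∈ f.dom := hf ▸ ⟨t, rfl⟩
  have := hd ⟨_, ht⟩
  rw [hf' t ht] at this
  linarith

namespace Close

variable {ι κ τ : Type*} {r s : ℝ}

/-- Copies of two families whose common parts have nearby copies exist for the whole families, at
the expense of an arbitrarily small error. -/
theorem exists_joint_of_sameType (hp : HP K) (nap : NAP K) [Finite ι] [Finite κ] [Finite τ]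
    (hA : IsStructureOf K A) (hB : IsStructureOf K B) {a : ι → A} {b : κ → B}
    (σ : τ → ι) (ρ : τ → κ) (hC : C ∈ K) {c c' : τ → C} (hc : SameType (fun t => a (σ t)) c)
    (hc' : SameType (fun t => b (ρ t)) c') {ε : ℝ} (hε : 0 < ε) :
    ∃ E ∈ K, ∃ (a' : ι → E) (b' : κ → E), SameType a a' ∧ SameType b b' ∧
      ∀ t, dist (a' (σ t)) (b' (ρ t)) < dist (c t) (c' t) + ε := by
  -- The family `a` is amalgamated with `C` over `c`, and the result with `b` over `c'`.
  obtain ⟨E, hE, a₁, d, ha₁, hd₁, h₁⟩ := NAP.exists_amalgam nap hA (hp C hC)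
    (b := Sum.elim c c') σ Sum.inl hc (half_pos hε)
  obtain ⟨F, hF, e, b₂, he, hb₂, h₂⟩ := NAP.exists_amalgam nap (hp E hE) hB
    (a := Sum.elim a₁ d) (τ := τ) (fun t => .inr (.inr t)) ρ
    ((hd₁.comp Sum.inr).symm.trans hc'.symm) (half_pos hε)
  refine ⟨F, hF, fun i => e (.inl i), b₂, ha₁.trans (he.comp Sum.inl), hb₂, fun t => ?_⟩
  have h3 : dist (a₁ (σ t)) (d (.inl t)) = dist (e (.inl (σ t))) (e (.inr (.inl t))) :=
    he.dist_eq (.inl (σ t)) (.inr (.inl t))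
  have h4 : dist (d (.inl t)) (d (.inr t)) = dist (e (.inr (.inl t))) (e (.inr (.inr t))) :=
    he.dist_eq (.inr (.inl t)) (.inr (.inr t))
  have h5 : dist (c t) (c' t) = dist (d (.inl t)) (d (.inr t)) := hd₁.dist_eq (.inl t) (.inr t)
  have h6 := dist_triangle4 (e (.inl (σ t))) (e (.inr (.inl t))) (e (.inr (.inr t))) (b₂ (ρ t))
  have h7 := h₁ t
  have h8 := h₂ t
  linarith

/-- Copies of two families that are close on a common part exist for the whole families. -/
theorem exists_joint (hp : HP K) (nap : NAP K) [Finite ι] [Finite κ] [Finite τ]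
    (hA : IsStructureOf K A) (hB : IsStructureOf K B) {a : ι → A} {b : κ → B}
    (σ : τ → ι) (ρ : τ → κ) (h : Close K (fun t => a (σ t)) (fun t => b (ρ t)) r) :
    ∃ E ∈ K, ∃ (a' : ι → E) (b' : κ → E), SameType a a' ∧ SameType b b' ∧
      ∀ t, dist (a' (σ t)) (b' (ρ t)) < r := by
  obtain ⟨s, hs, C, hC, c, c', hc, hc', hd⟩ := h.exists_lt
  obtain ⟨E, hE, a', b', ha, hb, h⟩ := exists_joint_of_sameType hp nap hA hB σ ρ hC hc hc'
    (sub_pos.2 hs)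
  exact ⟨E, hE, a', b', ha, hb, fun t => by linarith [h t, hd t]⟩

theorem trans (hp : HP K) (nap : NAP K) [Finite ι] (hA : IsStructureOf K A)
    {a : ι → A} {b : ι → B} {c : ι → C} (h : Close K a b r) (h' : Close K b c s) :
    Close K a c (r + s) := by
  obtain ⟨D, hD, d, d', hd, hd', hdd⟩ := h'
  obtain ⟨E, hE, a₁, e, ha, he, h₁⟩ := exists_joint hp nap hA (hp D hD) (a := a)
    (b := Sum.elim d d') id Sum.inl (h.congr_right hd)
  refine ⟨E, hE, a₁, fun i => e (.inr i), ha, hd'.trans (he.comp Sum.inr), fun i => ?_⟩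
  have h2 : dist (d i) (d' i) = dist (e (.inl i)) (e (.inr i)) := he.dist_eq (.inl i) (.inr i)
  have h3 := hdd i
  have h4 := h₁ i
  have h5 := dist_triangle (a₁ i) (e (.inl i)) (e (.inr i))
  simp only [id] at h4
  linarith

/-- Families indexed by the empty type are close. -/
theorem of_isEmpty (jep : JEP K) [IsEmpty ι] (hA : IsStructureOf K A) (hB : IsStructureOf K B)
    (a : ι → A) (b : ι → B) : Close K a b r := by
  obtain ⟨C, hC, ⟨g⟩, ⟨k⟩⟩ := jep _ (hA.gen_mem a) _ (hB.gen_mem b)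
  exact ⟨C, hC, fun i => g (genTuple a i), fun i => k (genTuple b i),
    (SameType.genTuple_left a).symm.trans (.of_embedding _ _),
    (SameType.genTuple_left b).symm.trans (.of_embedding _ _), fun i => isEmptyElim i⟩

end Close

end MetricStructure

/-! ### Approximate isometries and joint embeddings -/

namespace Apx

variable {X Y : Type*} [MetricSpace X] [MetricSpace Y]

/-- The approximate isometry `ψ + ε`. -/
noncomputable def addConst (ψ : Apx X Y) (ε : ℝ≥0∞) : Apx X Y :=
  ⟨fun x y => ψ x y + ε, by
    refine ⟨fun y x x' => ⟨?_, ?_⟩, fun x y y' => ⟨?_, ?_⟩⟩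
    · rw [← add_assoc]; exact add_le_add_left (ψ.2.1 y x x').1 _
    · exact (ψ.2.1 y x x').2.trans (add_le_add le_self_add le_self_add)
    · rw [← add_assoc]; exact add_le_add_left (ψ.2.2 x y y').1 _
    · exact (ψ.2.2 x y y').2.trans (add_le_add le_self_add le_self_add)⟩

/-- The approximate isometry `(x, y) ↦ d(f x, g y)` of two isometries with the same codomain. -/
def ofJoint {Z : Type*} [MetricSpace Z] (f : X → Z) (hf : Isometry f) (g : Y → Z)
    (hg : Isometry g) : Apx X Y :=
  ⟨fun x y => edist (f x) (g y), by
    refine ⟨fun y x x' => ⟨?_, ?_⟩, fun x y y' => ⟨?_, ?_⟩⟩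
    · rw [← hf.edist_eq x x']; exact edist_triangle _ _ _
    · rw [← hf.edist_eq x x']; exact edist_triangle_right _ _ _
    · rw [← hg.edist_eq y y', add_comm, edist_comm (g y)]; exact edist_triangle _ _ _
    · rw [← hg.edist_eq y y']; exact edist_triangle_left _ _ _⟩

theorem le_edist_add (ψ : Apx X Y) (x x' : X) (y y' : Y) :
    ψ x y ≤ edist x x' + ψ x' y' + edist y' y := by
  calc ψ x y ≤ edist x x' + ψ x' y := (ψ.2.1 y x x').1
    _ ≤ edist x x' + (edist y y' + ψ x' y') := by gcongr; exact (ψ.2.2 x' y y').1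
    _ = _ := by rw [edist_comm y y', add_assoc, add_comm (edist y' y)]

theorem continuous_eval (x : X) (y : Y) : Continuous fun ψ : Apx X Y => ψ x y :=
  (continuous_apply y).comp ((continuous_apply x).comp continuous_induced_dom)

theorem tendsto_addConst (ψ : Apx X Y) :
    Filter.Tendsto (fun ε : ℝ≥0∞ => ψ.addConst ε) (𝓝 0) (𝓝 ψ) := by
  rw [nhds_induced, Filter.tendsto_comap_iff, tendsto_pi_nhds]
  refine fun x => tendsto_pi_nhds.2 fun y => ?_
  have : Filter.Tendsto (fun ε : ℝ≥0∞ => ψ x y + ε) (𝓝 0) (𝓝 (ψ x y + 0)) :=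
    (continuous_const.add continuous_id).tendsto 0
  rwa [add_zero] at this

/-- A finite set of strict upper bounds for `φ` whose extension lies below `ψ` witnesses that `φ`
strictly refines `ψ`. -/
theorem strictlyRefines_of_iInf_le {τ : Type*} [Finite τ] {φ ψ : Apx X Y} (p : τ → X) (q : τ → Y)
    (r : τ → ℝ≥0∞) (h : ∀ t, φ (p t) (q t) < r t)
    (hψ : ∀ x y, ⨅ t, edist x (p t) + r t + edist (q t) y ≤ ψ x y) : φ.StrictlyRefines ψ := by
  refine mem_interior.2 ⟨⋂ t, {ρ : Apx X Y | ρ (p t) (q t) < r t}, fun ρ hρ x y => ?_,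
    isOpen_iInter_of_finite fun t => isOpen_lt (continuous_eval _ _) continuous_const,
    Set.mem_iInter.2 h⟩
  refine le_trans (le_iInf fun t => ?_) (hψ x y)
  refine (ρ.le_edist_add x (p t) y (q t)).trans ?_
  gcongr
  exact (Set.mem_iInter.1 hρ t).le

theorem StrictlyRefines.le {φ ψ : Apx X Y} (h : φ.StrictlyRefines ψ) : φ ≤ ψ :=
  interior_subset (s := {ρ : Apx X Y | ρ ≤ ψ}) h

/-- A strict refinement leaves room for a positive constant. -/
theorem StrictlyRefines.exists_addConst_le {φ ψ : Apx X Y} (h : φ.StrictlyRefines ψ) :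
    ∃ ε : ℝ, 0 < ε ∧ φ.addConst (ENNReal.ofReal ε) ≤ ψ := by
  have h1 : ∀ᶠ ε in 𝓝 (0 : ℝ≥0∞), φ.addConst ε ∈ interior {ρ : Apx X Y | ρ ≤ ψ} :=
    φ.tendsto_addConst (isOpen_interior.mem_nhds h)
  have h2 : Filter.Tendsto ENNReal.ofReal (𝓝[>] 0) (𝓝 0) := by
    have := (ENNReal.continuous_ofReal.tendsto 0).mono_left (nhdsWithin_le_nhds (s := Set.Ioi 0))
    simpa using this
  obtain ⟨ε, hε, hpos⟩ := ((h2.eventually h1).and self_mem_nhdsWithin).exists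
  exact ⟨ε, hpos, interior_subset hε⟩

theorem trivialExtension_apply {S : Set X} {T : Set Y} (ψ : Apx S T) (x : X) (y : Y) :
    ψ.trivialExtension x y = ⨅ s : S, edist (s : X) x + ⨅ t : T, ψ s t + edist (t : Y) y := rfl

end Apx

namespace MetricStructure

variable {L : FirstOrder.Language.{v, w}} {A B C D : MetricStructure.{u} L}
variable {K : Set (MetricStructure.{u} L)}

/-- A strictly approximate isomorphism lies, by a positive margin, above the approximate isometry
that is induced by nearby copies of two finite families in a member of `K`. -/
theorem exists_of_mem_stx {ψ : Apx A B} (hψ : ψ ∈ stx K A B) :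
    ∃ C ∈ K, ∃ (ι κ : Type u) (_ : Finite ι) (_ : Finite κ) (a : ι → A) (b : κ → B) (c : ι → C)
      (c' : κ → C) (ε : ℝ), SameType a c ∧ SameType b c' ∧ 0 < ε ∧ ∀ x y,
        (⨅ i, ⨅ j, edist x (a i) + (edist (c i) (c' j) + ENNReal.ofReal ε) + edist (b j) y) ≤
          ψ x y := by
  obtain ⟨-, φ, hφ, hφψ⟩ := hψ
  -- The interior of the refinements of `ψ` meets the coarsenings whose closure contains `φ`.
  obtain ⟨ρ, hρψ, σ, ⟨C, hC, g, f, rfl⟩, hσρ⟩ := mem_closure_iff.1 hφ _ isOpen_interior hφψ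
  obtain ⟨ε, hε, hle⟩ := Apx.StrictlyRefines.exists_addConst_le hρψ
  refine ⟨C, hC, g.dom, f.dom, g.finite_dom, f.finite_dom, Subtype.val, f.toFun, g.toFun,
    Subtype.val, ε, g.sameType, f.sameType.symm, hε, fun x y => le_trans ?_ (hle x y)⟩
  refine le_trans ?_ (add_le_add_left (hσρ x y) _)
  change _ ≤ (⨅ z, (⨅ s : g.dom, edist (s : A) x + edist (g.toFun s) z) +
    ⨅ t : f.dom, edist (t : C) z + edist (f.toFun t) y) + ENNReal.ofReal ε
  simp only [ENNReal.iInf_add, ENNReal.add_iInf]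
  refine le_iInf fun z => le_iInf fun s => le_iInf fun t => (iInf₂_le t s).trans ?_
  calc edist x t + (edist (g.toFun t) s + ENNReal.ofReal ε) + edist (f.toFun s) y
      ≤ edist (t : A) x + ((edist (g.toFun t) z + edist (s : C) z) + ENNReal.ofReal ε)
        + edist (f.toFun s) y := by
        rw [edist_comm x]; gcongr; exact edist_triangle_right _ _ _
    _ = _ := by ring

/-- The converse of `exists_of_mem_stx`. -/
theorem mem_stx_of_iInf_le (hC : C ∈ K) {ι κ : Type*} [Finite ι] [Finite κ] {a : ι → A} {b : κ → B}
    {c : ι → C} {c' : κ → C} (hc : SameType a c) (hc' : SameType b c') {ε : ℝ} (hε : 0 < ε)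
    {ψ : Apx A B} (hψ : ∀ x y,
      (⨅ i, ⨅ j, edist x (a i) + (edist (c i) (c' j) + ENNReal.ofReal ε) + edist (b j) y) ≤
        ψ x y) : ψ ∈ stx K A B := by
  obtain ⟨g, hg, hg'⟩ := hc.exists_finitePartialIso
  obtain ⟨f, hf, hf'⟩ := hc'.symm.exists_finitePartialIso
  have hle : ∀ i j, f.toApx.comp g.toApx (a i) (b j) ≤ edist (c i) (c' j) := fun i j => by
    have hi : a i ∈ g.dom := hg ▸ ⟨i, rfl⟩
    have hj : c' j ∈ f.dom := hf ▸ ⟨j, rfl⟩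
    refine (iInf_le _ (c i)).trans ?_
    refine (add_le_add (iInf_le _ ⟨a i, hi⟩) (iInf_le _ ⟨c' j, hj⟩)).trans ?_
    change (edist (a i) (a i) + edist (g.toFun ⟨a i, hi⟩) (c i)) +
      (edist (c' j) (c i) + edist (f.toFun ⟨c' j, hj⟩) (b j)) ≤ _
    rw [hg', hf']
    simp [edist_comm]
  have href : (f.toApx.comp g.toApx).StrictlyRefines ψ := by
    refine Apx.strictlyRefines_of_iInf_le (τ := ι × κ) (fun t => a t.1) (fun t => b t.2)
      (fun t => edist (c t.1) (c' t.2) + ENNReal.ofReal ε) (fun t => ?_) fun x y => ?_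
    · exact (hle t.1 t.2).trans_lt (ENNReal.lt_add_right (edist_ne_top _ _) (by simpa using hε))
    · rw [iInf_prod]; exact hψ x y
  have hmem : f.toApx.comp g.toApx ∈ apxTwo K A B := ⟨C, hC, g, f, rfl⟩
  exact ⟨subset_closure ⟨_, hmem, href.le⟩, _, subset_closure ⟨_, hmem, fun _ _ => le_rfl⟩, href⟩

/-- A strictly approximate isomorphism bounds from above the distances between suitable copies, in
a member of `K`, of any two finite families. -/
theorem exists_edist_le_of_mem_stx (hp : HP K) (nap : NAP K) (hA : IsStructureOf K A)
    (hB : IsStructureOf K B) {ψ : Apx A B} (hψ : ψ ∈ stx K A B) {ι κ : Type*} [Finite ι] [Finite κ]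
    (a : ι → A) (b : κ → B) : ∃ E ∈ K, ∃ (a' : ι → E) (b' : κ → E), SameType a a' ∧
      SameType b b' ∧ ∀ i j, edist (a' i) (b' j) ≤ ψ (a i) (b j) := by
  obtain ⟨C, hC, ι', κ', _, _, α, β, c, c', ε, hc, hc', hε, hle⟩ := exists_of_mem_stx hψ
  obtain ⟨E, hE, a', b', ha, hb, h⟩ := Close.exists_joint_of_sameType hp nap hA hB
    (a := Sum.elim a α) (b := Sum.elim b β) (τ := ι' × κ') (fun t => .inr t.1) (fun t => .inr t.2)
    hC (hc.comp Prod.fst) (hc'.comp Prod.snd) hε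
  refine ⟨E, hE, fun i => a' (.inl i), fun j => b' (.inl j), ha.comp Sum.inl, hb.comp Sum.inl,
    fun i j => le_trans (le_iInf fun i' => le_iInf fun j' => ?_) (hle _ _)⟩
  have h1 : edist (a i) (α i') = edist (a' (.inl i)) (a' (.inr i')) := by
    rw [edist_dist, edist_dist]; exact congrArg _ (ha.dist_eq (.inl i) (.inr i'))
  have h2 : edist (β j') (b j) = edist (b' (.inr j')) (b' (.inl j)) := by
    rw [edist_dist, edist_dist]; exact congrArg _ (hb.dist_eq (.inr j') (.inl j))
  rw [h1, h2]
  refine (edist_triangle4 _ (a' (.inr i')) (b' (.inr j')) _).trans ?_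
  gcongr
  rw [edist_dist, edist_dist, ← ENNReal.ofReal_add dist_nonneg hε.le]
  exact ENNReal.ofReal_le_ofReal (h (i', j')).le

/-- The intrinsic distance between two tuples in terms of their joint embeddings. -/
theorem Generated.distK_lt_ofReal_iff (hp : HP K) (nap : NAP K) {n : ℕ} {a b : Generated K n}
    {r : ℝ} (hr : 0 < r) : a.distK b < ENNReal.ofReal r ↔ Close K a.tuple b.tuple r := by
  constructor
  · intro h
    simp only [Generated.distK, iInf_lt_iff] at h
    obtain ⟨ψ, ⟨hψ, -⟩, hlt⟩ := h
    obtain ⟨E, hE, a', b', ha, hb, h⟩ := exists_edist_le_of_mem_stx hp nap (hp _ a.mem)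
      (hp _ b.mem) hψ a.tuple b.tuple
    refine ⟨E, hE, a', b', ha, hb, fun i => ?_⟩
    have := ((h i i).trans (le_iSup (fun i => ψ (a.tuple i) (b.tuple i)) i)).trans_lt hlt
    rwa [edist_dist, ENNReal.ofReal_lt_ofReal_iff hr] at this
  · intro h
    obtain ⟨s₀, hs₀, h₀⟩ := h.exists_lt
    obtain ⟨s, hs, hsr⟩ := exists_between (max_lt hs₀ hr)
    obtain ⟨E, hE, c, c', hc, hc', hd⟩ := h₀.mono ((le_max_left _ _).trans hs.le)
    have hs0 : 0 < s := (le_max_right _ _).trans_lt hs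
    obtain ⟨g, hg⟩ := hc.exists_embedding a.span_eq
    obtain ⟨k, hk⟩ := hc'.exists_embedding b.span_eq
    let ψ₀ : Apx (Set.range a.tuple) (Set.range b.tuple) :=
      (Apx.ofJoint (fun x : Set.range a.tuple => g x) (g.isometry.comp isometry_subtype_coe)
        (fun y : Set.range b.tuple => k y) (k.isometry.comp isometry_subtype_coe)).addConst
        (ENNReal.ofReal ((r - s) / 2))
    have hmem : ψ₀.trivialExtension ∈ Generated.stx a b := by
      refine ⟨mem_stx_of_iInf_le hE hc hc' (ε := (r - s) / 2) (by linarith) fun x y => ?_, ψ₀, rfl⟩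
      simp only [Apx.trivialExtension_apply, ENNReal.add_iInf]
      refine le_iInf fun ⟨_, i, rfl⟩ => le_iInf fun ⟨_, j, rfl⟩ => (iInf₂_le i j).trans ?_
      change _ ≤ edist (a.tuple i) x + (edist (g (a.tuple i)) (k (b.tuple j)) + _ + _)
      rw [hg, hk, edist_comm x, add_assoc]
    refine (iInf₂_le _ hmem).trans_lt (lt_of_le_of_lt (iSup_le fun i => ?_)
      ((ENNReal.ofReal_lt_ofReal_iff hr).2 (show s + (r - s) / 2 < r by linarith)))
    rw [Apx.trivialExtension_apply]
    refine (iInf_le _ ⟨_, i, rfl⟩).trans ?_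
    refine (add_le_add_right (iInf_le _ ⟨_, i, rfl⟩) _).trans ?_
    change edist (a.tuple i) (a.tuple i) + (edist (g (a.tuple i)) (k (b.tuple i)) +
      ENNReal.ofReal ((r - s) / 2) + edist (b.tuple i) (b.tuple i)) ≤ _
    rw [hg, hk, edist_self, edist_self, zero_add, add_zero, edist_dist,
      ENNReal.ofReal_add hs0.le (by linarith)]
    gcongr
    exact (hd i).le

/-- The member of `K_n` given by a tuple in a structure whose age lies in `K`. -/
def IsStructureOf.toGenerated (hA : IsStructureOf K A) {n : ℕ} (a : Fin n → A) : Generated K n :=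
  ⟨A.gen a, hA.gen_mem a, genTuple a, span_range_genTuple a⟩

end MetricStructure

/-! ### Ages of approximately ultra-homogeneous structures -/

/-- Dependent choice along a sequence of types. -/
theorem exists_seq_of_forall_exists {α : ℕ → Type*} (P : ∀ k, α k → Prop)
    (R : ∀ k, α k → α (k + 1) → Prop) (h₀ : ∃ x, P 0 x)
    (h : ∀ k x, P k x → ∃ y, P (k + 1) y ∧ R k x y) :
    ∃ x : ∀ k, α k, (∀ k, P k (x k)) ∧ ∀ k, R k (x k) (x (k + 1)) := by
  choose f hf using fun k (x : {x // P k x}) => h k x.1 x.2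
  let x : ∀ k, {x // P k x} :=
    Nat.rec ⟨h₀.choose, h₀.choose_spec⟩ fun k y => ⟨f k y, (hf k y).1⟩
  exact ⟨fun k => (x k).1, fun k => (x k).2, fun k => (hf k (x k)).2⟩

theorem exists_ofReal_le {ε : ℝ≥0∞} (hε : 0 < ε) : ∃ r : ℝ, 0 < r ∧ ENNReal.ofReal r ≤ ε := by
  obtain ⟨r, hr, hrε⟩ := ENNReal.lt_iff_exists_nnreal_btwn.1 hε
  exact ⟨r, by simpa using hr, by simpa using hrε.le⟩

namespace MetricStructure

variable {L : FirstOrder.Language.{v, w}} {A B C D M : MetricStructure.{u} L}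
variable {K : Set (MetricStructure.{u} L)}

/-- Two finitely generated structures that embed in `M` embed in a finitely generated substructure
of `M`. -/
theorem exists_mem_age_of_embeddings (hA : A.FinitelyGenerated) (hB : B.FinitelyGenerated)
    (e : Embedding A M) (k : Embedding B M) : ∃ C ∈ M.age, ∃ (g : Embedding A C)
      (h : Embedding B C) (i : Embedding C M), (∀ x, i (g x) = e x) ∧ ∀ x, i (h x) = k x := by
  obtain ⟨S, hS, hSu⟩ := hA
  obtain ⟨T, hT, hTu⟩ := hB
  let U : Set M := e '' S ∪ k '' T
  have hU : M.IsSubstructure (Set.range (Embedding.incl M U)) := Embedding.isSubstructure_range _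
  have hsub : U ⊆ Set.range (Embedding.incl M U) := fun x hx => ⟨⟨x, M.subset_span U hx⟩, rfl⟩
  obtain ⟨g, hg⟩ := (Embedding.incl M U).exists_lift e fun x => e.mem_of_span_eq_univ hSu hU
    (fun y hy => hsub (.inl ⟨y, hy, rfl⟩)) x
  obtain ⟨h, hh⟩ := (Embedding.incl M U).exists_lift k fun x => k.mem_of_span_eq_univ hTu hU
    (fun y hy => hsub (.inr ⟨y, hy, rfl⟩)) x
  exact ⟨M.generated U, ⟨finitelyGenerated_generated ((hS.image e).union (hT.image k)),
    ⟨Embedding.incl M U⟩⟩, g, h, Embedding.incl M U, hg, hh⟩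

namespace IsApproximatelyUltrahomogeneous

/-- A member of the age of `M` embeds in `M` with prescribed approximate values on a finite
family. -/
theorem exists_embedding_near (hM : M.IsApproximatelyUltrahomogeneous) (hC : C ∈ M.age)
    {ι : Type*} [Finite ι] {x : ι → M} {c : ι → C} (h : SameType x c) {ε : ℝ} (hε : 0 < ε) :
    ∃ e : Embedding C M, ∀ i, dist (x i) (e (c i)) < ε := by
  obtain ⟨-, ⟨k⟩⟩ := hC
  obtain ⟨φ, hdom, hφ⟩ := ((h.trans (.of_embedding k c)).symm).exists_finitePartialIso
  obtain ⟨f, hf⟩ := hM.2 φ ε hε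
  refine ⟨k.trans f.toEmbedding, fun i => ?_⟩
  have hi : k (c i) ∈ φ.dom := hdom ▸ ⟨i, rfl⟩
  have := hf ⟨_, hi⟩
  rwa [hφ i hi] at this

/-- Closeness to a tuple of `M` is realized in `M`. -/
theorem exists_realization (hM : M.IsApproximatelyUltrahomogeneous) {ι : Type*} [Finite ι]
    {x : ι → M} {b : ι → B} {r : ℝ} (h : Close M.age x b r) :
    ∃ y : ι → M, SameType b y ∧ ∀ i, dist (x i) (y i) < r := by
  obtain ⟨s, hs, C, hC, c, c', hc, hc', hd⟩ := h.exists_lt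
  obtain ⟨e, he⟩ := hM.exists_embedding_near hC hc (sub_pos.2 hs)
  refine ⟨fun i => e (c' i), hc'.trans (.of_embedding e c'), fun i => ?_⟩
  have := dist_triangle (x i) (e (c i)) (e (c' i))
  rw [e.isometry.dist_eq] at this
  linarith [he i, hd i]

theorem hp_age (M : MetricStructure.{u} L) : HP M.age :=
  fun _ ⟨_, ⟨e⟩⟩ _ ⟨hB, ⟨k⟩⟩ => ⟨hB, ⟨k.trans e⟩⟩

theorem jep_age (M : MetricStructure.{u} L) : JEP M.age := by
  rintro A ⟨hA, ⟨e⟩⟩ B ⟨hB, ⟨k⟩⟩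
  obtain ⟨C, hC, g, h, -⟩ := exists_mem_age_of_embeddings hA hB e k
  exact ⟨C, hC, ⟨g⟩, ⟨h⟩⟩

theorem nap_age (hM : M.IsApproximatelyUltrahomogeneous) : NAP M.age := by
  rintro A hA B ⟨hB, ⟨k⟩⟩ f ε hε
  have := f.finite_dom.to_subtype
  obtain ⟨e, he⟩ := hM.exists_embedding_near hA (x := fun s => k (f.toFun s))
    (f.sameType.trans (.of_embedding k _)).symm hε
  obtain ⟨C, hC, g, h, i, hg, hh⟩ := exists_mem_age_of_embeddings hA.1 hB e k
  refine ⟨C, hC, g, h, fun a => ?_⟩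
  rw [← i.isometry.dist_eq, hg, hh, dist_comm]
  exact (he a).le

theorem distK_lt_iff (hM : M.IsApproximatelyUltrahomogeneous) {n : ℕ} {a b : Generated M.age n}
    {r : ℝ} (hr : 0 < r) : a.distK b < ENNReal.ofReal r ↔ Close M.age a.tuple b.tuple r :=
  Generated.distK_lt_ofReal_iff (hp_age M) hM.nap_age hr

theorem exists_dense_generated (hM : M.IsApproximatelyUltrahomogeneous) (n : ℕ) :
    ∃ D : Set (Generated M.age n), D.Countable ∧
      ∀ (a : Generated M.age n) (ε : ℝ≥0∞), 0 < ε → ∃ b ∈ D, a.distK b < ε := by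
  have := hM.1
  have hsub : IsStructureOf M.age M := subset_rfl
  obtain ⟨s, hs, hd⟩ := TopologicalSpace.exists_countable_dense (Fin n → M)
  refine ⟨hsub.toGenerated '' s, hs.image _, fun a ε hε => ?_⟩
  obtain ⟨r, hr, hrε⟩ := exists_ofReal_le hε
  obtain ⟨-, ⟨e⟩⟩ := a.mem
  obtain ⟨y, hy, hys⟩ := hd.exists_dist_lt (fun i => e (a.tuple i)) hr
  refine ⟨_, ⟨y, hy, rfl⟩, lt_of_lt_of_le ((hM.distK_lt_iff hr).2 ?_) hrε⟩
  exact ((Close.of_dist_lt hsub ((dist_pi_lt_iff hr).1 hys)).congr_left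
    (.of_embedding e _)).congr_right (SameType.genTuple_left y).symm

theorem exists_limit_generated (hM : M.IsApproximatelyUltrahomogeneous) {n : ℕ}
    (s : ℕ → Generated M.age n)
    (hs : ∀ ε : ℝ≥0∞, 0 < ε → ∃ N, ∀ i ≥ N, ∀ j ≥ N, (s i).distK (s j) < ε) :
    ∃ a : Generated M.age n, ∀ ε : ℝ≥0∞, 0 < ε → ∃ N, ∀ i ≥ N, (s i).distK a < ε := by
  have hsub : IsStructureOf M.age M := subset_rfl
  have hpos : ∀ k : ℕ, (0 : ℝ) < (1 / 2) ^ k := fun k => by positivity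
  choose N hN using fun k : ℕ => hs (ENNReal.ofReal ((1 / 2) ^ k)) (ENNReal.ofReal_pos.2 (hpos k))
  let ν : ℕ → ℕ := fun k => ∑ j ∈ Finset.range (k + 1), N j
  have hν : ∀ k, N k ≤ ν k := fun k =>
    Finset.single_le_sum (f := N) (fun _ _ => Nat.zero_le _) (Finset.self_mem_range_succ k)
  have hν' : ∀ k, N k ≤ ν (k + 1) := fun k =>
    (hν k).trans (Finset.sum_le_sum_of_subset (Finset.range_mono (Nat.le_succ _)))
  -- Realize a fast subsequence by a convergent sequence of tuples of `M`.
  obtain ⟨x, hx, hxd⟩ := exists_seq_of_forall_exists (α := fun _ => Fin n → M)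
    (fun k x => SameType (s (ν k)).tuple x) (fun k x y => ∀ i, dist (x i) (y i) < (1 / 2) ^ k)
    (by
      obtain ⟨-, ⟨e⟩⟩ := (s (ν 0)).mem
      exact ⟨_, .of_embedding e _⟩)
    (fun k x hx => hM.exists_realization
      (((hM.distK_lt_iff (hpos k)).1 (hN k _ (hν k) _ (hν' k))).congr_left hx.symm))
  obtain ⟨y, hy⟩ := cauchySeq_tendsto_of_complete (cauchySeq_of_le_geometric (1 / 2) 1
    (by norm_num) (fun k => by
      rw [one_mul]
      exact (dist_pi_le_iff (hpos k).le).2 fun i => (hxd k i).le) : CauchySeq x)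
  refine ⟨hsub.toGenerated y, fun ε hε => ?_⟩
  obtain ⟨r, hr, hrε⟩ := exists_ofReal_le hε
  obtain ⟨k, hk, hky⟩ := (((tendsto_pow_atTop_nhds_zero_of_lt_one (by norm_num : (0 : ℝ) ≤ 1 / 2)
    (by norm_num)).eventually_lt_const (half_pos hr)).and
      ((Metric.tendsto_nhds.1 hy) (r / 2) (half_pos hr))).exists
  refine ⟨N k, fun i hi => lt_of_lt_of_le ((hM.distK_lt_iff hr).2 ?_) hrε⟩
  have h1 := ((hM.distK_lt_iff (hpos k)).1 (hN k i hi _ (hν k))).mono hk.le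
  have h2 : Close M.age (x k) y (r / 2) :=
    .of_dist_lt hsub ((dist_pi_lt_iff (half_pos hr)).1 hky)
  have h3 := h1.trans (hp_age M) hM.nap_age (hp_age M _ (s i).mem) (h2.congr_left (hx k))
  rw [add_halves] at h3
  exact h3.congr_right (SameType.genTuple_left y).symm

theorem cp_age (hM : M.IsApproximatelyUltrahomogeneous) : CP M.age := by
  have hsub : IsStructureOf M.age M := subset_rfl
  constructor
  · intro n R a ε hε
    obtain ⟨-, ⟨e⟩⟩ := a.mem
    obtain ⟨δ, hδ, h⟩ := Metric.continuous_iff.1 (M.continuous_pred R)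
      (fun i => e (a.tuple i)) ε hε
    refine ⟨ENNReal.ofReal δ, ENNReal.ofReal_pos.2 hδ, fun b hb => ?_⟩
    obtain ⟨y, hy, hd⟩ := hM.exists_realization
      (((hM.distK_lt_iff hδ).1 hb).congr_left (SameType.of_embedding e _).symm)
    have := h y ((dist_pi_lt_iff hδ).2 fun i => dist_comm (y i) _ ▸ hd i)
    rw [show b.str.pred R b.tuple = M.pred R y from hy.pred_eq R id, ← e.map_pred, abs_sub_comm]
    exact this
  · intro n m f a ε hε
    obtain ⟨r, hr, hrε⟩ := exists_ofReal_le hε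
    obtain ⟨-, ⟨e⟩⟩ := a.mem
    obtain ⟨δ, hδ, h⟩ := Metric.continuous_iff.1
      ((M.continuous_func f).comp (by fun_prop : Continuous fun (x : Fin (n + m) → M) =>
        fun i => x (Fin.castAdd m i))) (fun i => e (a.tuple i)) r hr
    have hδr := lt_min hδ hr
    refine ⟨ENNReal.ofReal (min δ r), ENNReal.ofReal_pos.2 hδr, fun b hb =>
      lt_of_lt_of_le ((hM.distK_lt_iff hr).2 ?_) hrε⟩
    obtain ⟨y, hy, hd⟩ := hM.exists_realization
      (((hM.distK_lt_iff hδr).1 hb).congr_left (SameType.of_embedding e _).symm)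
    obtain ⟨k, hk⟩ := hy.exists_embedding b.span_eq
    refine ((Close.of_dist_lt hsub (a := fun i => e ((a.adjoin f).tuple i))
      (a' := fun i => k ((b.adjoin f).tuple i)) fun i => ?_).congr_left
        (SameType.of_embedding e (a.adjoin f).tuple)).congr_right (SameType.of_embedding k _).symm
    refine Fin.lastCases ?_ (fun i => ?_) i
    · have := h y ((dist_pi_lt_iff hδ).2 fun i =>
        dist_comm (y i) _ ▸ (hd i).trans_le (min_le_left _ _))
      simp only [Generated.adjoin, Fin.snoc_last]
      rw [← e.map_func, ← k.map_func, dist_comm]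
      simp only [hk]
      exact this
    · simp only [Generated.adjoin, Fin.snoc_castSucc, hk]
      exact (hd i).trans_le (min_le_right _ _)

theorem isFraisseClass_age (hM : M.IsApproximatelyUltrahomogeneous) : IsFraisseClass M.age where
  finitelyGenerated _ hA := hA.1
  hp := hp_age M
  jep := jep_age M
  nap := hM.nap_age
  pp n := ⟨hM.exists_dense_generated n, hM.exists_limit_generated⟩
  cp := hM.cp_age

end IsApproximatelyUltrahomogeneous

/-! ### Limits and the one-point extension property -/

/-- The approximate one-point extension property: whenever a member `C` of `K` contains a copy `c`
of a tuple `x` of `M`, each point `y` of `C` is approximately realized over `x` in `M`. -/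
def Rich (K : Set (MetricStructure.{u} L)) (M : MetricStructure.{u} L) : Prop :=
  ∀ (ι : Type) [Finite ι] (x : ι → M), ∀ C ∈ K, ∀ (c : ι → C) (y : C), SameType x c →
    ∀ ε : ℝ, 0 < ε → ∃ z : M, Close K (Option.elim' z x) (Option.elim' y c) ε

/-- The partial isomorphism `c i ↦ x i`, enlarged by a constant, is a strictly approximate
isomorphism; a refinement of it that is almost total at `y` provides the required point. -/
theorem IsFraisseLimit.rich (hp : HP K) (nap : NAP K) (hM : IsFraisseLimit K M) : Rich K M := by
  intro ι _ x C hC c y hxc ε hε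
  obtain ⟨f, hdom, hf⟩ := hxc.symm.exists_finitePartialIso
  have hε3 : 0 < ε / 3 := by positivity
  have hψ : f.toApx.addConst (ENNReal.ofReal (ε / 3)) ∈ stx K C M := by
    refine mem_stx_of_iInf_le hC (SameType.refl c) hxc hε3 fun u v => ?_
    change _ ≤ (⨅ s : f.dom, edist (s : C) u + edist (f.toFun s) v) + _
    rw [ENNReal.iInf_add]
    refine le_iInf fun ⟨s, hs⟩ => ?_
    obtain ⟨i, rfl⟩ : s ∈ Set.range c := hdom ▸ hs
    refine (iInf₂_le i i).trans (le_of_eq ?_)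
    rw [hf i hs, edist_self, zero_add, edist_comm u]
    ring
  obtain ⟨φ, hφ, hφψ, htot⟩ := hM.2.2 C (hp C hC) (insert y (Set.range c))
    ((Set.finite_range c).insert y) _ hψ (ε / 3) hε3
  obtain ⟨z, hz⟩ := htot y (Set.mem_insert _ _) (ENNReal.ofReal ε)
    ((ENNReal.ofReal_lt_ofReal_iff hε).2 (by linarith))
  obtain ⟨E, hE, a', b', ha, hb, h⟩ := exists_edist_le_of_mem_stx hp nap (hp C hC) hM.2.1 hφ
    (Option.elim' y c) (Option.elim' z x)
  refine ⟨z, E, hE, b', a', hb, ha, ?_⟩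
  rintro (_ | i)
  · have := (h none none).trans_lt hz
    rwa [edist_dist, ENNReal.ofReal_lt_ofReal_iff hε, dist_comm] at this
  · have hi : c i ∈ f.dom := hdom ▸ ⟨i, rfl⟩
    have h1 : φ (c i) (x i) ≤ ENNReal.ofReal (ε / 3) := by
      refine (hφψ.le (c i) (x i)).trans ?_
      change (⨅ s : f.dom, edist (s : C) (c i) + edist (f.toFun s) (x i)) + _ ≤ _
      refine (add_le_add_left (iInf_le _ ⟨c i, hi⟩) _).trans (le_of_eq ?_)
      rw [hf i hi, edist_self, edist_self, zero_add, zero_add]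
    have := ((h (some i) (some i)).trans h1).trans_lt
      ((ENNReal.ofReal_lt_ofReal_iff hε).2 (by linarith))
    rwa [edist_dist, ENNReal.ofReal_lt_ofReal_iff hε, dist_comm] at this

/-- The required refinement is obtained from a finite partial isomorphism that is total on `S`. -/
theorem IsApproximatelyUltrahomogeneous.isFraisseLimit (hM : M.IsApproximatelyUltrahomogeneous) :
    IsFraisseLimit M.age M := by
  have hsub : IsStructureOf M.age M := subset_rfl
  refine ⟨hM.1, hsub, fun A hA S hS ψ hψ ε hε => ?_⟩
  obtain ⟨C, hC, ι, κ, _, _, a, b, c, c', δ, hc, hc', hδ, hle⟩ := exists_of_mem_stx hψ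
  have := hS.to_subtype
  -- The structure generated by `S` and the family `a` embeds in `M`, near `b`.
  obtain ⟨E, hE, α, β, hα, hβ, h₁⟩ := Close.exists_joint_of_sameType (hp_age M) hM.nap_age hA hsub
    (a := Sum.elim (Subtype.val : S → A) a) (b := b) (τ := ι × κ) (fun t => .inr t.1) (fun t => t.2)
    hC (hc.comp Prod.fst) (hc'.comp Prod.snd) (ε := δ / 4) (by positivity)
  obtain ⟨e, he⟩ := hM.exists_embedding_near hE hβ (ε := δ / 4) (by positivity)
  have hm := hα.trans (.of_embedding e α)
  obtain ⟨f, hdom, hf⟩ := hm.exists_finitePartialIso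
  have hη : 0 < min ε (δ / 4) := lt_min hε (by positivity)
  set η := min ε (δ / 4)
  have hφ : f.toApx.addConst (ENNReal.ofReal η) ∈ stx M.age A M := by
    refine mem_stx_of_iInf_le hE hα (SameType.of_embedding e α).symm hη fun u v => ?_
    change _ ≤ (⨅ s : f.dom, edist (s : A) u + edist (f.toFun s) v) + _
    rw [ENNReal.iInf_add]
    refine le_iInf fun ⟨s, hs⟩ => ?_
    obtain ⟨i, rfl⟩ : s ∈ Set.range _ := hdom ▸ hs
    refine (iInf₂_le i i).trans (le_of_eq ?_)
    rw [hf i hs, edist_self, zero_add, edist_comm u]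
    ring
  have hval : ∀ i, f.toApx.addConst (ENNReal.ofReal η) (Sum.elim Subtype.val a i) (e (α i)) ≤
      ENNReal.ofReal η := fun i => by
    have hi : Sum.elim (Subtype.val : S → A) a i ∈ f.dom := hdom ▸ ⟨i, rfl⟩
    change (⨅ s : f.dom, edist (s : A) _ + edist (f.toFun s) _) + _ ≤ _
    refine (add_le_add_left (iInf_le _ ⟨_, hi⟩) _).trans (le_of_eq ?_)
    rw [hf i hi, edist_self, edist_self, zero_add, zero_add]
  refine ⟨_, hφ, ?_, fun s hs t ht => ⟨e (α (.inl ⟨s, hs⟩)), ?_⟩⟩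
  · refine Apx.strictlyRefines_of_iInf_le _ _ (fun _ => ENNReal.ofReal (2 * η))
      (fun i => (hval i).trans_lt ((ENNReal.ofReal_lt_ofReal_iff (by positivity)).2 (by linarith)))
      fun u v => le_trans (le_iInf fun i => le_iInf fun j => ?_) (hle u v)
    refine (iInf_le _ (.inr i)).trans ?_
    change edist u (a i) + _ + edist (e (α (.inr i))) v ≤ _
    rw [add_assoc, add_assoc]
    refine add_le_add_right ?_ _
    calc ENNReal.ofReal (2 * η) + edist (e (α (.inr i))) v
        ≤ ENNReal.ofReal (2 * η) + (edist (e (α (.inr i))) (e (β j)) + edist (e (β j)) (b j)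
          + edist (b j) v) := by gcongr; exact edist_triangle4 _ _ _ _
      _ = ENNReal.ofReal (2 * η) + (edist (e (α (.inr i))) (e (β j)) + edist (e (β j)) (b j))
          + edist (b j) v := by ring
      _ ≤ _ := add_le_add_left ?_ _
    rw [e.isometry.edist_eq, edist_dist, edist_dist, edist_dist, ← ENNReal.ofReal_add,
      ← ENNReal.ofReal_add, ← ENNReal.ofReal_add]
    · refine ENNReal.ofReal_le_ofReal ?_
      have h2 := h₁ (i, j)
      have h3 := he j
      have h4 : η ≤ δ / 4 := min_le_right _ _
      rw [dist_comm] at h3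
      simp only at h2
      linarith
    all_goals positivity
  · exact ((hval (.inl ⟨s, hs⟩)).trans (ENNReal.ofReal_le_ofReal (min_le_left _ _))).trans_lt ht

namespace Rich

variable {r ε : ℝ}

/-- The extension property for a family that is only close to a family of `M`. -/
theorem exists_close (h : Rich K M) (hp : HP K) (nap : NAP K) (hM : IsStructureOf K M)
    {ι : Type} [Finite ι] {x : ι → M} (hA : IsStructureOf K A) {a : ι → A} (y : A)
    (hr : 0 < r) (hxa : Close K x a r) :
    ∃ z : M, Close K (Option.elim' z x) (Option.elim' y a) r := by
  obtain ⟨E, hE, x', a', hx, ha, hd⟩ := Close.exists_joint hp nap hM hA (a := x)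
    (b := Option.elim' y a) id some hxa
  obtain ⟨s, hs, hd'⟩ := exists_lt_of_forall_lt (ι := Option ι) (f := Option.elim' 0
    fun i => dist (x' i) (a' (some i))) (r := r) (by rintro (_ | i); exacts [hr, hd i])
  obtain ⟨z, hz⟩ := h ι x E hE x' (a' none) hx (r - s) (sub_pos.2 hs)
  have h1 : Close K (Option.elim' (a' none) x') a' s := by
    refine Close.of_dist_lt (hp E hE) ?_
    rintro (_ | i)
    · simpa using hd' none
    · exact hd' (some i)
  refine ⟨z, ?_⟩
  have h3 := (h1.symm.trans hp nap (hp E hE) hz.symm).symm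
  rw [add_sub_cancel] at h3
  exact h3.congr_right ha.symm

/-- The extension property for finite families of new points. -/
theorem exists_close_sum (h : Rich K M) (hp : HP K) (nap : NAP K) (hM : IsStructureOf K M)
    (hA : IsStructureOf K A) (hr : 0 < r) {ι κ : Type} [Finite ι] [Finite κ] {x : ι → M}
    {a : ι → A} (y : κ → A) (hxa : Close K x a r) :
    ∃ z : κ → M, Close K (Sum.elim x z) (Sum.elim a y) r := by
  suffices ∀ y : κ → A, ∃ z : κ → M, Close K (Sum.elim x z) (Sum.elim a y) r from this y
  clear y
  refine Finite.induction_empty_option (P := fun κ => ∀ y : κ → A, ∃ z : κ → M,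
    Close K (Sum.elim x z) (Sum.elim a y) r) ?_ ?_ ?_ κ
  · intro κ κ' e ih y
    obtain ⟨z, hz⟩ := ih fun k => y (e k)
    refine ⟨fun k => z (e.symm k), ?_⟩
    convert hz.comp (Sum.map id e.symm) using 1 <;> ext (i | k) <;> simp
  · refine fun y => ⟨PEmpty.elim, ?_⟩
    convert hxa.comp (Sum.elim id PEmpty.elim) using 1 <;> ext (i | k)
    all_goals first | rfl | exact k.elim
  · intro κ _ ih y
    obtain ⟨z, hz⟩ := ih fun k => y (some k)
    obtain ⟨t, ht⟩ := h.exists_close hp nap hM hA (y none) hr hz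
    refine ⟨Option.elim' t z, ?_⟩
    convert ht.comp (Sum.elim (fun i => some (.inl i)) (Option.elim' none fun k => some (.inr k)))
      using 1 <;> ext (i | _ | k) <;> rfl

/-- A family close to a tuple of `M` has copies in `M` up to an arbitrarily small error. -/
theorem exists_realization (h : Rich K M) (hp : HP K) (nap : NAP K) (hM : IsStructureOf K M)
    (hA : IsStructureOf K A) (hε : 0 < ε) {ι κ : Type} [Finite ι] [Finite κ] {x : ι → M}
    {a : κ → A} (σ : ι → κ) (hxa : Close K x (fun i => a (σ i)) r) :
    ∃ z : κ → M, Close K z a ε ∧ ∀ i, dist (x i) (z (σ i)) < r := by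
  obtain ⟨s, hs, hxa⟩ := hxa.exists_lt
  obtain ⟨E, hE, x', a', hx, ha, hd⟩ := Close.exists_joint hp nap hM hA (a := x) (b := a) id σ hxa
  have hδ : 0 < min ε ((r - s) / 2) := lt_min hε (by linarith)
  obtain ⟨z, hz⟩ := h.exists_close_sum hp nap hM (hp E hE) hδ a'
    (Close.of_sameType hM hx hδ)
  refine ⟨z, ((hz.comp Sum.inr).mono (min_le_left _ _)).congr_right ha.symm, fun i => ?_⟩
  have h1 : dist (x i) (z (σ i)) < dist (x' i) (a' (σ i)) + 2 * min ε ((r - s) / 2) :=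
    hz.symm.dist_lt (.inl i) (.inr (σ i))
  have h2 := hd i
  have h3 := min_le_right ε ((r - s) / 2)
  simp only [id] at h2
  linarith

end Rich

/-! ### Continuity of the symbols with respect to joint embeddings -/

namespace IsFraisseClass

theorem exists_pred_close (hK : IsFraisseClass K) (hA : IsStructureOf K A) {n : ℕ}
    (R : L.Relations n) (a : Fin n → A) {ε : ℝ} (hε : 0 < ε) :
    ∃ δ > 0, ∀ (B : MetricStructure.{u} L), IsStructureOf K B → ∀ b : Fin n → B,
      Close K a b δ → |A.pred R a - B.pred R b| < ε := by
  obtain ⟨δ, hδ, h⟩ := hK.cp.1 n R (hA.toGenerated a) ε hε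
  obtain ⟨r, hr, hrδ⟩ := exists_ofReal_le hδ
  refine ⟨r, hr, fun B hB b hab => h (hB.toGenerated b) (lt_of_lt_of_le ?_ hrδ)⟩
  exact (Generated.distK_lt_ofReal_iff hK.hp hK.nap hr).2
    ((hab.congr_left (SameType.genTuple_left a)).congr_right (SameType.genTuple_left b).symm)

theorem exists_snoc_func_close (hK : IsFraisseClass K) (hA : IsStructureOf K A) {n m : ℕ}
    (f : L.Functions n) (a : Fin (n + m) → A) {ε : ℝ} (hε : 0 < ε) :
    ∃ δ > 0, ∀ (B : MetricStructure.{u} L), IsStructureOf K B → ∀ b : Fin (n + m) → B,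
      Close K a b δ →
        Close K (Fin.snoc (α := fun _ => A) a (A.func f fun i => a (Fin.castAdd m i)))
          (Fin.snoc (α := fun _ => B) b (B.func f fun i => b (Fin.castAdd m i))) ε := by
  obtain ⟨δ, hδ, h⟩ := hK.cp.2 n m f (hA.toGenerated a) _ (ENNReal.ofReal_pos.2 hε)
  obtain ⟨r, hr, hrδ⟩ := exists_ofReal_le hδ
  have key : ∀ (B : MetricStructure.{u} L) (hB : IsStructureOf K B) (b : Fin (n + m) → B),
      SameType ((hB.toGenerated b).adjoin f).tuple
        (Fin.snoc (α := fun _ => B) b (B.func f fun i => b (Fin.castAdd m i))) := fun B hB b => by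
    have h1 := SameType.of_embedding (Embedding.incl B (Set.range b))
      ((hB.toGenerated b).adjoin f).tuple
    have h2 : (fun i => Embedding.incl B (Set.range b) (((hB.toGenerated b).adjoin f).tuple i)) =
        Fin.snoc (α := fun _ => B) b (B.func f fun i => b (Fin.castAdd m i)) := by
      funext i
      refine Fin.lastCases ?_ (fun i => ?_) i
      · simp only [Generated.adjoin, Fin.snoc_last]; rfl
      · simp only [Generated.adjoin, Fin.snoc_castSucc]; rfl
    exact h2 ▸ h1
  refine ⟨r, hr, fun B hB b hab => ?_⟩
  have h1 := h (hB.toGenerated b) (lt_of_lt_of_le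
    ((Generated.distK_lt_ofReal_iff hK.hp hK.nap hr).2
      ((hab.congr_left (SameType.genTuple_left a)).congr_right
        (SameType.genTuple_left b).symm)) hrδ)
  exact (((Generated.distK_lt_ofReal_iff hK.hp hK.nap hε).1 h1).congr_left
    (key A hA a).symm).congr_right (key B hB b)

/-- Function symbols are continuous near the copies of a given tuple, with a modulus that does not
depend on the structure in which the copy lies. -/
theorem exists_func_close (hK : IsFraisseClass K) (hA : IsStructureOf K A) {n : ℕ}
    (f : L.Functions n) (a : Fin n → A) {ε : ℝ} (hε : 0 < ε) :
    ∃ δ > 0, ∀ (B : MetricStructure.{u} L), IsStructureOf K B → ∀ b b' : Fin n → B,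
      Close K a b δ → (∀ i, dist (b i) (b' i) < δ) → dist (B.func f b) (B.func f b') < ε := by
  -- The tuple `(b, f b')` is close to `(a, f a)`, hence `(b, f b', f b)` to `(a, f a, f a)`.
  obtain ⟨δ₂, hδ₂, h₂⟩ := hK.exists_snoc_func_close hA (m := 1) f
    (Fin.snoc (α := fun _ => A) a (A.func f a)) (half_pos hε)
  obtain ⟨δ₁, hδ₁, h₁⟩ := hK.exists_snoc_func_close hA (m := 0) f a (half_pos hδ₂)
  have hδ : 0 < min (δ₁ / 2) (δ₂ / 2) := lt_min (half_pos hδ₁) (half_pos hδ₂)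
  refine ⟨_, hδ, fun B hB b b' hab hd => ?_⟩
  have h3 : Close K a b' δ₁ := by
    refine (hab.trans hK.hp hK.nap hA (Close.of_dist_lt hB hd)).mono ?_
    linarith [min_le_left (δ₁ / 2) (δ₂ / 2)]
  have h4 : Close K (Fin.snoc (α := fun _ => B) b' (B.func f b'))
      (Fin.snoc (α := fun _ => B) b (B.func f b')) (δ₂ / 2) := by
    refine Close.of_dist_lt hB fun i => Fin.lastCases ?_ (fun i => ?_) i
    · simpa using hδ₂
    · simpa [dist_comm] using ((hd i).trans_le (min_le_right _ _))
  have h5 := (h₁ B hB b' h3).trans hK.hp hK.nap hA h4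
  rw [add_halves] at h5
  have h6 := (h₂ B hB _ h5).dist_lt (Fin.last (n + 1)) (Fin.castSucc (Fin.last n))
  have h7 : ∀ {C : MetricStructure.{u} L} (c : Fin n → C) (z : C),
      (fun i => Fin.snoc (α := fun _ => C) c z (Fin.castAdd 1 i)) = c := fun c z =>
    funext fun i => Fin.snoc_castSucc (α := fun _ => _) _ _ i
  rw [Fin.snoc_last, Fin.snoc_castSucc, Fin.snoc_last, Fin.snoc_last, Fin.snoc_castSucc,
    Fin.snoc_last, h7, h7, dist_self] at h6
  linarith

end IsFraisseClass

/-! ### Types are determined by approximate types -/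

/-- The points `x` and `y` are close in every joint embedding in which the families `a` and `b` are
sufficiently close. -/
def Controlled (K : Set (MetricStructure.{u} L)) {ι : Type*} (a : ι → A) (b : ι → B) (x : A)
    (y : B) : Prop :=
  ∀ ε > 0, ∃ δ > 0, ∀ C ∈ K, ∀ (g : Embedding A C) (h : Embedding B C),
    (∀ i, dist (g (a i)) (h (b i)) < δ) → dist (g x) (h y) < ε

theorem exists_pos_forall_le {ι : Type*} [Finite ι] {δ : ι → ℝ} (h : ∀ i, 0 < δ i) :
    ∃ r > 0, ∀ i, r ≤ δ i := by
  obtain ⟨s, hs, h⟩ := exists_lt_of_forall_lt (f := fun i => -δ i) (r := 0) fun i => by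
    linarith [h i]
  exact ⟨-s, by linarith, fun i => by linarith [h i]⟩

namespace Controlled

variable {ι : Type*} {a : ι → A} {b : ι → B}

theorem base (a : ι → A) (b : ι → B) (i : ι) : Controlled K a b (a i) (b i) :=
  fun ε hε => ⟨ε, hε, fun _ _ _ _ h => h i⟩

theorem exists_uniform {κ : Type*} [Finite κ] {x : κ → A} {y : κ → B}
    (h : ∀ k, Controlled K a b (x k) (y k)) {ε : ℝ} (hε : 0 < ε) :
    ∃ δ > 0, ∀ C ∈ K, ∀ (g : Embedding A C) (h : Embedding B C),
      (∀ i, dist (g (a i)) (h (b i)) < δ) → ∀ k, dist (g (x k)) (h (y k)) < ε := by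
  choose δ hδ h using fun k => h k ε hε
  obtain ⟨r, hr, hle⟩ := exists_pos_forall_le hδ
  exact ⟨r, hr, fun C hC g k hd j => h j C hC g k fun i => (hd i).trans_le (hle j)⟩

theorem func (hK : IsFraisseClass K) (hA : IsStructureOf K A) {n : ℕ} {x : Fin n → A}
    {y : Fin n → B} (h : ∀ k, Controlled K a b (x k) (y k)) (f : L.Functions n) :
    Controlled K a b (A.func f x) (B.func f y) := by
  intro ε hε
  obtain ⟨δ, hδ, hf⟩ := hK.exists_func_close hA f x hε
  obtain ⟨r, hr, hx⟩ := exists_uniform h hδ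
  refine ⟨r, hr, fun C hC g k hd => ?_⟩
  rw [← g.map_func, ← k.map_func]
  exact hf C (hK.hp C hC) _ _ (Close.of_sameType hA (.of_embedding g x) hδ) (hx C hC g k hd)

theorem of_forall_near {x : A} {y : B} (h : ∀ ε > 0, ∃ x' y', Controlled K a b x' y' ∧
    dist x x' < ε ∧ dist y y' < ε) : Controlled K a b x y := by
  intro ε hε
  obtain ⟨x', y', hc, hx, hy⟩ := h (ε / 3) (by positivity)
  obtain ⟨δ, hδ, h⟩ := hc (ε / 3) (by positivity)
  refine ⟨δ, hδ, fun C hC g k hd => ?_⟩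
  have h1 := h C hC g k hd
  have h2 := dist_triangle4 (g x) (g x') (k y') (k y)
  rw [g.isometry.dist_eq, k.isometry.dist_eq, dist_comm y'] at h2
  linarith

/-- Each point of a structure generated by `a` is controlled by `a`. -/
theorem self (hK : IsFraisseClass K) (hA : IsStructureOf K A)
    (ha : A.span (Set.range a) = Set.univ) (x : A) : Controlled K a a x x := by
  have hS : A.IsSubstructure {x | Controlled K a a x x} := by
    refine ⟨isClosed_of_closure_subset fun x hx => of_forall_near fun ε hε => ?_, fun f y hy =>
      func hK hA hy f⟩
    obtain ⟨x', hx', hd⟩ := Metric.mem_closure_iff.1 hx ε hε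
    exact ⟨x', x', hx', hd, hd⟩
  refine span_subset hS ?_ (ha ▸ Set.mem_univ x)
  rintro _ ⟨i, rfl⟩
  exact base a a i

end Controlled

theorem Close.exists_embeddings {ι : Type*} {a : ι → A} {b : ι → B} {r : ℝ}
    (ha : A.span (Set.range a) = Set.univ) (hb : B.span (Set.range b) = Set.univ)
    (h : Close K a b r) : ∃ C ∈ K, ∃ (g : Embedding A C) (k : Embedding B C),
      ∀ i, dist (g (a i)) (k (b i)) < r := by
  obtain ⟨C, hC, c, c', hc, hc', hd⟩ := h
  obtain ⟨g, hg⟩ := hc.exists_embedding ha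
  obtain ⟨k, hk⟩ := hc'.exists_embedding hb
  exact ⟨C, hC, g, k, fun i => by rw [hg, hk]; exact hd i⟩

/-- If two generating families are arbitrarily close, then the points controlled by them form the
graph of an embedding. -/
theorem IsFraisseClass.sameType_of_span (hK : IsFraisseClass K) (hA : IsStructureOf K A)
    (hB : IsStructureOf K B) {ι : Type*} {a : ι → A} {b : ι → B}
    (ha : A.span (Set.range a) = Set.univ) (hb : B.span (Set.range b) = Set.univ)
    (h : ∀ r > 0, Close K a b r) : SameType a b := by
  -- The pairs of controlled points form the graph of an isometry.
  have hiso : ∀ {x x' : A} {y y' : B}, Controlled K a b x y → Controlled K a b x' y' →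
      dist x x' = dist y y' := fun {x x' y y'} hxy hxy' => by
    refine eq_of_forall_dist_le fun ε hε => ?_
    obtain ⟨δ, hδ, hx⟩ := hxy (ε / 2) (half_pos hε)
    obtain ⟨δ', hδ', hx'⟩ := hxy' (ε / 2) (half_pos hε)
    obtain ⟨C, hC, g, k, hd⟩ := (h _ (lt_min hδ hδ')).exists_embeddings ha hb
    have h1 := hx C hC g k fun i => (hd i).trans_le (min_le_left _ _)
    have h2 := hx' C hC g k fun i => (hd i).trans_le (min_le_right _ _)
    rw [← g.isometry.dist_eq, ← k.isometry.dist_eq]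
    have := dist_dist_dist_le (g x) (g x') (k y) (k y')
    linarith
  -- Its domain is a substructure that contains the generators.
  have hS : A.IsSubstructure {x | ∃ y, Controlled K a b x y} := by
    refine ⟨isClosed_of_closure_subset fun x hx => ?_, fun f x hx => ?_⟩
    · obtain ⟨x', hx', hlim⟩ := mem_closure_iff_seq_limit.1 hx
      choose y hy using hx'
      have hcau : CauchySeq y := by
        refine Metric.cauchySeq_iff.2 fun ε hε => ?_
        obtain ⟨N, hN⟩ := Metric.cauchySeq_iff.1 hlim.cauchySeq ε hε
        exact ⟨N, fun m hm n hn => hiso (hy m) (hy n) ▸ hN m hm n hn⟩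
      obtain ⟨z, hz⟩ := cauchySeq_tendsto_of_complete hcau
      refine ⟨z, Controlled.of_forall_near fun ε hε => ?_⟩
      obtain ⟨n, h1, h2⟩ := ((Metric.tendsto_nhds.1 hlim ε hε).and
        (Metric.tendsto_nhds.1 hz ε hε)).exists
      exact ⟨x' n, y n, hy n, dist_comm x _ ▸ h1, dist_comm z _ ▸ h2⟩
    · choose y hy using hx
      exact ⟨_, Controlled.func hK hA hy f⟩
  have hall : ∀ x, ∃ y, Controlled K a b x y := fun x => by
    refine span_subset hS ?_ (ha ▸ Set.mem_univ x)
    rintro _ ⟨i, rfl⟩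
    exact ⟨b i, Controlled.base a b i⟩
  choose e he using hall
  have huniq : ∀ {x y}, Controlled K a b x y → e x = y := fun {x y} hxy =>
    dist_eq_zero.1 (by rw [← hiso (he x) hxy, dist_self])
  refine ⟨A, a, .refl A, ⟨e, .of_dist_eq fun x y => (hiso (he x) (he y)).symm, fun R x => ?_,
    fun f x => (huniq (Controlled.func hK hA (fun k => he (x k)) f)).symm⟩, fun _ => rfl,
    fun i => huniq (Controlled.base a b i)⟩
  refine eq_of_forall_dist_le fun ε hε => ?_
  obtain ⟨δ, hδ, hR⟩ := hK.exists_pred_close hA R x hε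
  obtain ⟨r, hr, hx⟩ := Controlled.exists_uniform (fun k => he (x k)) hδ
  obtain ⟨C, hC, g, k, hd⟩ := (h r hr).exists_embeddings ha hb
  rw [dist_comm]
  exact (hR B hB _ ⟨C, hC, _, _, .of_embedding g x, .of_embedding k _, hx C hC g k hd⟩).le

/-- Families that are arbitrarily close have the same type. -/
theorem IsFraisseClass.sameType_of_close (hK : IsFraisseClass K) (hA : IsStructureOf K A)
    (hB : IsStructureOf K B) {ι : Type*} {a : ι → A} {b : ι → B}
    (h : ∀ r > 0, Close K a b r) : SameType a b := by
  have h1 := SameType.genTuple_left a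
  have h2 := SameType.genTuple_left b
  exact h1.symm.trans ((hK.sameType_of_span (hA.of_embedding (Embedding.incl A _))
    (hB.of_embedding (Embedding.incl B _)) (span_range_genTuple a) (span_range_genTuple b)
    fun r hr => ((h r hr).congr_left h1).congr_right h2.symm).trans h2)

end MetricStructure

/-! ### Back and forth -/

/-- Limits of families whose `i`-th member moves, from stage `i - n` on, by geometrically decreasing
amounts. -/
theorem exists_limit_of_geometric {X : Type*} [MetricSpace X] [CompleteSpace X] {n : ℕ} {ε : ℝ}
    (s : ℕ → ℕ → X) (h : ∀ j i, i < n + j → dist (s j i) (s (j + 1) i) ≤ ε / 2 ^ j) :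
    ∃ x : ℕ → X, ∀ j i, i < n + j → dist (s j i) (x i) ≤ 2 * ε / 2 ^ j := by
  have key : ∀ j i, i < n + j → ∀ m,
      dist (s (j + m) i) (s (j + (m + 1)) i) ≤ 2 * ε / 2 ^ j / 2 / 2 ^ m := fun j i hi m => by
    refine (h (j + m) i (by omega)).trans (le_of_eq ?_)
    rw [pow_add]
    field_simp
  choose x hx using fun i => cauchySeq_tendsto_of_complete
    (cauchySeq_of_le_geometric_two (key (i + 1) i (by omega)))
  refine ⟨x, fun j i hi => ?_⟩
  have h1 : Filter.Tendsto (fun m => s m i) Filter.atTop (𝓝 (x i)) := by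
    have := hx i
    simp only [add_comm (i + 1)] at this
    exact (Filter.tendsto_add_atTop_iff_nat (i + 1)).1 this
  have h2 : Filter.Tendsto (fun m => s (j + m) i) Filter.atTop (𝓝 (x i)) := by
    simp only [add_comm j]
    exact (Filter.tendsto_add_atTop_iff_nat j).2 h1
  exact dist_le_of_le_geometric_two_of_tendsto₀ (key j i hi) h2

theorem DenseRange.of_dist_le {X : Type*} [MetricSpace X] {u x : ℕ → X} (hu : DenseRange u) {ε : ℝ}
    (h : ∀ i t, ∃ k, dist (u i) (x k) ≤ ε / 2 ^ t) : DenseRange x := by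
  refine Metric.denseRange_iff.2 fun p r hr => ?_
  obtain ⟨i, hi⟩ := Metric.denseRange_iff.1 hu p (r / 2) (half_pos hr)
  have hlim : Filter.Tendsto (fun t : ℕ => ε / (2 : ℝ) ^ t) Filter.atTop (𝓝 0) :=
    tendsto_const_nhds.div_atTop (tendsto_pow_atTop_atTop_of_one_lt one_lt_two)
  obtain ⟨t, ht⟩ := (hlim.eventually_lt_const (half_pos hr)).exists
  obtain ⟨k, hk⟩ := h i t
  exact ⟨k, by linarith [dist_triangle p (u i) (x k)]⟩

namespace MetricStructure

variable {L : FirstOrder.Language.{v, w}} {A B C D M N : MetricStructure.{u} L}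
variable {K : Set (MetricStructure.{u} L)}

theorem SameType.comp_of_fin {a : ℕ → A} {b : ℕ → B}
    (h : ∀ m, SameType (fun i : Fin m => a i) (fun i : Fin m => b i)) {κ : Type*} [Finite κ]
    (σ : κ → ℕ) : SameType (fun k => a (σ k)) (fun k => b (σ k)) := by
  obtain ⟨m, hm⟩ := (Set.finite_range σ).bddAbove
  exact (h (m + 1)).comp fun k => ⟨σ k, Nat.lt_succ_of_le (hm ⟨k, rfl⟩)⟩

/-- A dense sequence and a sequence of the same type determine an embedding. -/
theorem exists_embedding_of_denseRange {x : ℕ → A} {y : ℕ → B} (hx : DenseRange x)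
    (h : ∀ m, SameType (fun i : Fin m => x i) (fun i : Fin m => y i)) :
    ∃ e : Embedding A B, ∀ i, e (x i) = y i := by
  have hd : ∀ i j, dist (x i) (x j) = dist (y i) (y j) := fun i j =>
    (SameType.comp_of_fin h (fun b : Bool => cond b i j)).dist_eq true false
  have hseq : ∀ p : A, ∃ k : ℕ → ℕ, Filter.Tendsto (fun m => x (k m)) Filter.atTop (𝓝 p) :=
    fun p => by
      obtain ⟨s, hs, hlim⟩ := mem_closure_iff_seq_limit.1 (hx p)
      choose k hk using hs
      exact ⟨k, by simpa only [hk] using hlim⟩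
  -- The image of a point is characterized by its distances to the sequence `y`.
  have hex : ∀ p : A, ∃ q : B, ∀ i, dist q (y i) = dist p (x i) := fun p => by
    obtain ⟨k, hk⟩ := hseq p
    have hcau : CauchySeq fun m => y (k m) := by
      refine Metric.cauchySeq_iff.2 fun ε hε => ?_
      obtain ⟨N, hN⟩ := Metric.cauchySeq_iff.1 hk.cauchySeq ε hε
      exact ⟨N, fun m hm n hn => hd _ _ ▸ hN m hm n hn⟩
    obtain ⟨q, hq⟩ := cauchySeq_tendsto_of_complete hcau
    refine ⟨q, fun i => tendsto_nhds_unique (hq.dist tendsto_const_nhds) ?_⟩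
    simp only [← hd]
    exact hk.dist tendsto_const_nhds
  -- A point is the limit of `y ∘ k` as soon as it has the right distances to the sequence `y`.
  have hlim : ∀ {p : A} {q : B}, (∀ i, dist q (y i) = dist p (x i)) → ∀ {k : ℕ → ℕ},
      Filter.Tendsto (fun m => x (k m)) Filter.atTop (𝓝 p) →
        Filter.Tendsto (fun m => y (k m)) Filter.atTop (𝓝 q) := fun {p q} hq {k} hk => by
    rw [tendsto_iff_dist_tendsto_zero] at hk ⊢
    simpa only [dist_comm _ q, hq, dist_comm p] using hk
  choose e he using hex
  have huniq : ∀ {p : A} {q : B}, (∀ i, dist q (y i) = dist p (x i)) → q = e p := fun {p q} hq => by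
    obtain ⟨k, hk⟩ := hseq p
    exact tendsto_nhds_unique (hlim hq hk) (hlim (he p) hk)
  have hiso : Isometry e := .of_dist_eq fun p p' => by
    obtain ⟨k, hk⟩ := hseq p'
    refine tendsto_nhds_unique (tendsto_const_nhds.dist (hlim (he p') hk)) ?_
    simp only [he p]
    exact tendsto_const_nhds.dist hk
  have hex' : ∀ i, e (x i) = y i := fun i => dist_eq_zero.1 (by rw [he, dist_self])
  have hdense : ∀ n, DenseRange fun (σ : Fin n → ℕ) i => x (σ i) := fun n =>
    DenseRange.piMap fun _ => hx
  refine ⟨⟨e, hiso, fun {n} R => ?_, fun {n} f => ?_⟩, hex'⟩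
  · refine congrFun ((hdense n).equalizer ((B.continuous_pred R).comp (by
      have := hiso.continuous; fun_prop)) (A.continuous_pred R) (funext fun σ => ?_))
    simp only [Function.comp, hex']
    exact ((SameType.comp_of_fin h σ).pred_eq R id).symm
  · refine congrFun ((hdense n).equalizer ((B.continuous_func f).comp (by
      have := hiso.continuous; fun_prop)) (hiso.continuous.comp (A.continuous_func f))
      (funext fun σ => ?_))
    simp only [Function.comp, hex']
    refine huniq fun i => ?_
    exact ((SameType.comp_of_fin h (Option.elim' i σ)).adjoin_func f some).symm.dist_eq none
      (some none)

theorem exists_isomorphism_of_denseRange {x : ℕ → A} {y : ℕ → B} (hx : DenseRange x)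
    (hy : DenseRange y) (h : ∀ m, SameType (fun i : Fin m => x i) (fun i : Fin m => y i)) :
    ∃ e : Isomorphism A B, ∀ i, e.toEmbedding (x i) = y i := by
  obtain ⟨e, he⟩ := exists_embedding_of_denseRange hx h
  refine ⟨⟨e, fun q => ?_⟩, he⟩
  refine closure_minimal ?_ e.isSubstructure_range.1 (hy q)
  rintro _ ⟨i, rfl⟩
  exact ⟨x i, he i⟩

/-- Approximate back and forth. The step, which adjoins one point to each of two finite sequences
that are close and improves their closeness at the expense of moving them, is iterated; the
resulting sequences converge to sequences of the same type. -/
theorem IsFraisseClass.exists_sameType_sequences (hK : IsFraisseClass K) (hA : IsStructureOf K A)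
    (hB : IsStructureOf K B) {Q : ℕ → A → B → Prop}
    (step : ∀ (j k : ℕ) (x : ℕ → A) (y : ℕ → B) (r δ : ℝ), 0 < r → 0 < δ →
      Close K (fun i : Fin k => x i) (fun i : Fin k => y i) r →
        ∃ (x' : ℕ → A) (y' : ℕ → B),
        Close K (fun i : Fin (k + 1) => x' i) (fun i : Fin (k + 1) => y' i) δ ∧
        (∀ i < k, dist (x i) (x' i) < r) ∧ (∀ i < k, dist (y i) (y' i) < r) ∧ Q j (x' k) (y' k))
    {n : ℕ} {x₀ : ℕ → A} {y₀ : ℕ → B} {ε : ℝ} (hε : 0 < ε)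
    (h₀ : Close K (fun i : Fin n => x₀ i) (fun i : Fin n => y₀ i) ε) :
    ∃ (x : ℕ → A) (y : ℕ → B), (∀ m, SameType (fun i : Fin m => x i) (fun i : Fin m => y i)) ∧
      (∀ i < n, dist (x₀ i) (x i) ≤ 2 * ε ∧ dist (y₀ i) (y i) ≤ 2 * ε) ∧
      ∀ j, ∃ p q, Q j p q ∧ dist p (x (n + j)) ≤ ε / 2 ^ j ∧ dist q (y (n + j)) ≤ ε / 2 ^ j := by
  have hpos : ∀ j : ℕ, 0 < ε / 2 ^ j := fun j => by positivity
  obtain ⟨s, hs, hstep⟩ := exists_seq_of_forall_exists (α := fun _ => (ℕ → A) × (ℕ → B))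
    (fun j s => Close K (fun i : Fin (n + j) => s.1 i) (fun i : Fin (n + j) => s.2 i) (ε / 2 ^ j) ∧
      (j = 0 → s = (x₀, y₀)))
    (fun j s s' => (∀ i < n + j, dist (s.1 i) (s'.1 i) < ε / 2 ^ j) ∧
      (∀ i < n + j, dist (s.2 i) (s'.2 i) < ε / 2 ^ j) ∧ Q j (s'.1 (n + j)) (s'.2 (n + j)))
    ⟨(x₀, y₀), by simpa using h₀, fun _ => rfl⟩ fun j s hs => by
      obtain ⟨x', y', h1, h2, h3, h4⟩ := step j (n + j) s.1 s.2 _ _ (hpos j) (hpos (j + 1)) hs.1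
      exact ⟨(x', y'), ⟨h1, fun h => by omega⟩, h2, h3, h4⟩
  obtain ⟨x, hx⟩ := exists_limit_of_geometric (n := n) (ε := ε) (fun j => (s j).1)
    fun j i hi => ((hstep j).1 i hi).le
  obtain ⟨y, hy⟩ := exists_limit_of_geometric (n := n) (ε := ε) (fun j => (s j).2)
    fun j i hi => ((hstep j).2.1 i hi).le
  refine ⟨x, y, fun m => hK.sameType_of_close hA hB fun r hr => ?_, fun i hi => ?_, fun j => ?_⟩
  · have hlim : Filter.Tendsto (fun t : ℕ => 2 * ε / (2 : ℝ) ^ t) Filter.atTop (𝓝 0) :=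
      tendsto_const_nhds.div_atTop (tendsto_pow_atTop_atTop_of_one_lt one_lt_two)
    obtain ⟨j, hj, hmj⟩ := ((hlim.eventually_lt_const (show 0 < r / 3 by positivity)).and
      (Filter.eventually_ge_atTop m)).exists
    have h1 : Close K (fun i : Fin m => x i) (fun i : Fin m => (s j).1 i) (r / 3) :=
      Close.of_dist_lt hA fun i => by
        rw [dist_comm]; exact (hx j i (by omega)).trans_lt hj
    have h2 : Close K (fun i : Fin m => (s j).2 i) (fun i : Fin m => y i) (r / 3) :=
      Close.of_dist_lt hB fun i => (hy j i (by omega)).trans_lt hj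
    have h3 : Close K (fun i : Fin m => (s j).1 i) (fun i : Fin m => (s j).2 i) (r / 3) := by
      refine ((hs j).1.comp (Fin.castLE (by omega : m ≤ n + j))).mono ?_
      have : 2 * ε / 2 ^ j = ε / 2 ^ j + ε / 2 ^ j := by ring
      linarith [hpos j]
    have h4 := (h1.trans hK.hp hK.nap hA h3).trans hK.hp hK.nap hA h2
    exact h4.mono (by linarith)
  · have h1 := hx 0 i (by omega)
    have h2 := hy 0 i (by omega)
    rw [(hs 0).2 rfl] at h1 h2
    simpa using And.intro h1 h2
  · have h : 2 * ε / 2 ^ (j + 1) = ε / 2 ^ j := by rw [pow_succ]; field_simp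
    exact ⟨_, _, (hstep j).2.2, h ▸ hx (j + 1) (n + j) (by omega),
      h ▸ hy (j + 1) (n + j) (by omega)⟩

/-- A step forth: any point `p` of `A` can be adjoined to the first of two close sequences. The
first sequence stays fixed, the second one moves by less than `r`. -/
theorem Rich.exists_forth (h : Rich K M) (hp : HP K) (nap : NAP K) (hM : IsStructureOf K M)
    (hA : IsStructureOf K A) {k : ℕ} {x : ℕ → A} {y : ℕ → M} {r δ : ℝ} (hr : 0 < r) (hδ : 0 < δ)
    (hxy : Close K (fun i : Fin k => x i) (fun i : Fin k => y i) r) (p : A) :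
    ∃ (x' : ℕ → A) (y' : ℕ → M),
      Close K (fun i : Fin (k + 1) => x' i) (fun i : Fin (k + 1) => y' i) δ ∧
      (∀ i < k, dist (x i) (x' i) < r) ∧ (∀ i < k, dist (y i) (y' i) < r) ∧ x' k = p := by
  have hupd : ∀ i < k, Function.update x k p i = x i := fun i hi =>
    Function.update_of_ne hi.ne _ _
  obtain ⟨z, hz, hd⟩ := h.exists_realization hp nap hM hA hδ (x := fun i : Fin k => y i)
    (a := fun i : Fin (k + 1) => Function.update x k p i) Fin.castSucc
    (r := r) (by
      convert hxy.symm using 1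
      exact funext fun i => hupd i i.2)
  -- The values from index `k + 1` on do not matter.
  refine ⟨Function.update x k p, fun i => if hi : i < k + 1 then z ⟨i, hi⟩ else y i, ?_,
    fun i hi => ?_, fun i hi => ?_, Function.update_self _ _ _⟩
  · convert hz.symm using 1
    exact funext fun i => dif_pos i.2
  · rw [hupd i hi, dist_self]; exact hr
  · simp only [dif_pos (show i < k + 1 by omega)]
    exact hd ⟨i, hi⟩

/-- Two separable structures with the extension property are isomorphic, by an isomorphism that
extends approximately a given correspondence of tuples. -/
theorem IsFraisseClass.exists_isomorphism_of_close (hK : IsFraisseClass K)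
    (hM : IsStructureOf K M) (hN : IsStructureOf K N) [TopologicalSpace.SeparableSpace M]
    [TopologicalSpace.SeparableSpace N] [Nonempty M] [Nonempty N] (hrM : Rich K M)
    (hrN : Rich K N) {n : ℕ} {x₀ : Fin n → M} {y₀ : Fin n → N} {ε : ℝ} (hε : 0 < ε)
    (h₀ : Close K x₀ y₀ ε) :
    ∃ f : Isomorphism M N, ∀ i, dist (f.toEmbedding (x₀ i)) (y₀ i) ≤ 4 * ε := by
  classical
  obtain ⟨u, hu⟩ := TopologicalSpace.exists_dense_seq M
  obtain ⟨v, hv⟩ := TopologicalSpace.exists_dense_seq N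
  -- Each member of the two dense sequences is treated infinitely often.
  obtain ⟨x, y, hxy, hxy₀, hQ⟩ := hK.exists_sameType_sequences hM hN (n := n)
    (Q := fun j p q => (j % 2 = 0 → p = u (Nat.unpair (j / 2)).1) ∧
      (j % 2 = 1 → q = v (Nat.unpair (j / 2)).1))
    (fun j k x y r δ hr hδ h => by
      rcases Nat.mod_two_eq_zero_or_one j with hj | hj
      · obtain ⟨x', y', h1, h2, h3, h4⟩ := hrN.exists_forth hK.hp hK.nap hN hM hr hδ h
          (u (Nat.unpair (j / 2)).1)
        exact ⟨x', y', h1, h2, h3, fun _ => h4, fun hj' => by omega⟩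
      · obtain ⟨y', x', h1, h2, h3, h4⟩ := hrM.exists_forth hK.hp hK.nap hM hN hr hδ h.symm
          (v (Nat.unpair (j / 2)).1)
        exact ⟨x', y', h1.symm, h3, h2, fun hj' => by omega, fun _ => h4⟩)
    (x₀ := fun i => if hi : i < n then x₀ ⟨i, hi⟩ else Classical.arbitrary M)
    (y₀ := fun i => if hi : i < n then y₀ ⟨i, hi⟩ else Classical.arbitrary N) hε
    (by convert h₀ using 1 <;> exact funext fun i => dif_pos i.2)
  have hle : ∀ i t b : ℕ, ε / 2 ^ (2 * Nat.pair i t + b) ≤ ε / 2 ^ t := fun i t b => by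
    have := Nat.right_le_pair i t
    gcongr
    · norm_num
    · omega
  -- The stage `2 * pair i t` puts a point of the limit within `ε / 2 ^ t` of `u i`.
  have hxd : DenseRange x := hu.of_dist_le (ε := ε) fun i t => by
    obtain ⟨p, q, ⟨h1, -⟩, h2, -⟩ := hQ (2 * Nat.pair i t + 0)
    rw [h1 (by omega)] at h2
    exact ⟨_, by simpa using h2.trans (hle i t 0)⟩
  have hyd : DenseRange y := hv.of_dist_le (ε := ε) fun i t => by
    obtain ⟨p, q, ⟨-, h1⟩, -, h2⟩ := hQ (2 * Nat.pair i t + 1)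
    have h3 : (2 * Nat.pair i t + 1) / 2 = Nat.pair i t := by omega
    rw [h1 (by omega), h3, Nat.unpair_pair] at h2
    exact ⟨_, h2.trans (hle i t 1)⟩
  obtain ⟨f, hf⟩ := exists_isomorphism_of_denseRange hxd hyd hxy
  refine ⟨f, fun i => ?_⟩
  obtain ⟨h1, h2⟩ := hxy₀ i i.2
  simp only [dif_pos i.2, Fin.eta] at h1 h2
  rw [← f.isometry.dist_eq, hf] at h1
  have := dist_triangle_right (f.toEmbedding (x₀ i)) (y₀ i) (y i)
  linarith

theorem Rich.nonempty_of_nonempty (h : Rich K M) (hp : HP K) (jep : JEP K) (nap : NAP K)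
    (hM : IsStructureOf K M) (hA : IsStructureOf K A) [Nonempty A] : Nonempty M :=
  let ⟨z, _⟩ := h.exists_close hp nap hM hA (Classical.arbitrary A) one_pos
    (Close.of_isEmpty jep hM hA (Empty.elim : Empty → M) (Empty.elim : Empty → A))
  ⟨z⟩

/-- An empty structure whose age lies in a Fraïssé class embeds in all structures whose age lies in
this class, since the nullary predicates take the same values. -/
theorem IsFraisseClass.exists_embedding_of_isEmpty (hK : IsFraisseClass K)
    (hM : IsStructureOf K M) (hA : IsStructureOf K A) [IsEmpty A] : Nonempty (Embedding A M) := by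
  have h : SameType (Empty.elim : Empty → A) (Empty.elim : Empty → M) :=
    hK.sameType_of_close hA hM fun r _ => Close.of_isEmpty hK.jep hA hM _ _
  obtain ⟨e, -⟩ := h.exists_embedding (Subsingleton.elim _ _)
  exact ⟨e⟩

theorem IsFraisseClass.nonempty_isomorphism (hK : IsFraisseClass K)
    (hM : IsStructureOf K M) (hN : IsStructureOf K N) [TopologicalSpace.SeparableSpace M]
    [TopologicalSpace.SeparableSpace N] (hrM : Rich K M) (hrN : Rich K N) :
    Nonempty (Isomorphism M N) := by
  cases isEmpty_or_nonempty M
  · obtain ⟨e⟩ := hK.exists_embedding_of_isEmpty (A := M) hN hM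
    refine ⟨⟨e, fun q => ?_⟩⟩
    have : Nonempty N := ⟨q⟩
    exact isEmptyElim (hrM.nonempty_of_nonempty hK.hp hK.jep hK.nap hM hN).some
  · have := hrN.nonempty_of_nonempty hK.hp hK.jep hK.nap hN hM
    obtain ⟨f, -⟩ := hK.exists_isomorphism_of_close hM hN hrM hrN one_pos (n := 0)
      (x₀ := fun i => i.elim0) (y₀ := fun i => i.elim0) (Close.of_isEmpty hK.jep hM hN _ _)
    exact ⟨f⟩

/-- Universality: the forth half of the argument. -/
theorem IsFraisseClass.nonempty_embedding (hK : IsFraisseClass K)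
    (hM : IsStructureOf K M) (hA : IsStructureOf K A) [TopologicalSpace.SeparableSpace A]
    (hrM : Rich K M) : Nonempty (Embedding A M) := by
  cases isEmpty_or_nonempty A
  · exact hK.exists_embedding_of_isEmpty hM hA
  · have := hrM.nonempty_of_nonempty hK.hp hK.jep hK.nap hM hA
    obtain ⟨u, hu⟩ := TopologicalSpace.exists_dense_seq A
    obtain ⟨x, y, hxy, -, hQ⟩ := hK.exists_sameType_sequences hA hM (n := 0)
      (Q := fun j p _ => p = u (Nat.unpair j).1)
      (fun j k x y r δ hr hδ h => hrM.exists_forth hK.hp hK.nap hM hA hr hδ h _)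
      (x₀ := fun _ => Classical.arbitrary A) (y₀ := fun _ => Classical.arbitrary M) one_pos
      (Close.of_isEmpty hK.jep hA hM _ _)
    have hxd : DenseRange x := hu.of_dist_le (ε := 1) fun i t => by
      obtain ⟨p, q, rfl, h2, -⟩ := hQ (Nat.pair i t)
      rw [Nat.unpair_pair] at h2
      refine ⟨_, h2.trans ?_⟩
      have := Nat.right_le_pair i t
      gcongr
      norm_num
    obtain ⟨e, -⟩ := exists_embedding_of_denseRange hxd hxy
    exact ⟨e⟩

theorem IsFraisseClass.isApproximatelyUltrahomogeneous (hK : IsFraisseClass K)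
    (hM : IsStructureOf K M) [hs : TopologicalSpace.SeparableSpace M] (hrM : Rich K M) :
    M.IsApproximatelyUltrahomogeneous := by
  refine ⟨hs, fun φ ε hε => ?_⟩
  cases isEmpty_or_nonempty M
  · exact ⟨⟨.refl M, Function.surjective_id⟩, fun a => isEmptyElim (a : M)⟩
  · have := φ.finite_dom.to_subtype
    obtain ⟨n, ⟨e⟩⟩ := Finite.exists_equiv_fin φ.dom
    obtain ⟨f, hf⟩ := hK.exists_isomorphism_of_close hM hM hrM hrM (ε := ε / 5) (by positivity)
      (Close.of_sameType hM (φ.sameType.comp e.symm) (by positivity))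
    refine ⟨f, fun a => ?_⟩
    have := hf (e a)
    rw [e.symm_apply_apply] at this
    rw [dist_comm]
    linarith

/-- Types of tuples in structures whose age lies in the class are realized exactly. -/
theorem IsFraisseClass.exists_sameType (hK : IsFraisseClass K)
    (hM : IsStructureOf K M) (hA : IsStructureOf K A) (hrM : Rich K M) {κ : Type} [Finite κ]
    (a : κ → A) : ∃ z : κ → M, SameType a z := by
  have := Fintype.ofFinite κ
  have hpos : ∀ j : ℕ, (0 : ℝ) < (1 / 2) ^ j := fun j => by positivity
  obtain ⟨z, hz, hzd⟩ := exists_seq_of_forall_exists (α := fun _ => κ → M)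
    (fun j z => Close K z a ((1 / 2) ^ j)) (fun j z z' => ∀ i, dist (z i) (z' i) < (1 / 2) ^ j)
    (by
      obtain ⟨z, hz, -⟩ := hrM.exists_realization hK.hp hK.nap hM hA (hpos 0) (r := 1)
        (x := (Empty.elim : Empty → M)) (a := a) Empty.elim (Close.of_isEmpty hK.jep hM hA _ _)
      exact ⟨z, hz⟩)
    fun j z hz => hrM.exists_realization hK.hp hK.nap hM hA (hpos (j + 1)) id hz
  obtain ⟨y, hy⟩ := cauchySeq_tendsto_of_complete (cauchySeq_of_le_geometric (1 / 2) 1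
    (by norm_num) (fun j => by
      rw [one_mul]
      exact (dist_pi_le_iff (hpos j).le).2 fun i => (hzd j i).le) : CauchySeq z)
  refine ⟨y, hK.sameType_of_close hA hM fun r hr => ?_⟩
  obtain ⟨j, hj, hjy⟩ := (((tendsto_pow_atTop_nhds_zero_of_lt_one (by norm_num : (0 : ℝ) ≤ 1 / 2)
    (by norm_num)).eventually_lt_const (half_pos hr)).and
      ((Metric.tendsto_nhds.1 hy) (r / 2) (half_pos hr))).exists
  have h1 := ((hz j).mono hj.le).symm.trans hK.hp hK.nap hA
    (Close.of_dist_lt hM ((dist_pi_lt_iff (half_pos hr)).1 hjy))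
  rwa [add_halves] at h1

theorem IsFraisseClass.age_eq (hK : IsFraisseClass K) (hM : IsStructureOf K M) (hrM : Rich K M) :
    M.age = K := by
  refine Set.Subset.antisymm hM fun A hA => ⟨hK.finitelyGenerated A hA, ?_⟩
  obtain ⟨S, hS, hSu⟩ := hK.finitelyGenerated A hA
  have := hS.to_subtype
  obtain ⟨n, ⟨e⟩⟩ := Finite.exists_equiv_fin S
  obtain ⟨z, hz⟩ := hK.exists_sameType hM (hK.hp A hA) hrM fun i => (e.symm i : A)
  obtain ⟨k, -⟩ := hz.exists_embedding (by
    rw [← hSu]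
    congr 1
    ext x
    constructor
    · rintro ⟨i, rfl⟩
      exact (e.symm i).2
    · exact fun hx => ⟨e ⟨x, hx⟩, by simp⟩)
  exact ⟨k⟩

end MetricStructure

/-! ### Generic sequences -/

/-- The completion of a pseudo-metric on `ℕ`. -/
theorem exists_complete_of_dist (d : ℕ → ℕ → ℝ) (hself : ∀ i, d i i = 0)
    (hcomm : ∀ i j, d i j = d j i) (htri : ∀ i j k, d i k ≤ d i j + d j k) :
    ∃ (X : Type u) (_ : MetricSpace X) (_ : CompleteSpace X) (p : ℕ → X), DenseRange p ∧
      ∀ i j, dist (p i) (p j) = d i j := by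
  have key : ∀ (Y : Type u) [PseudoMetricSpace Y] (q : ℕ → Y), Function.Surjective q →
      (∀ i j, dist (q i) (q j) = d i j) → ∃ (X : Type u) (_ : MetricSpace X) (_ : CompleteSpace X)
        (p : ℕ → X), DenseRange p ∧ ∀ i j, dist (p i) (p j) = d i j := fun Y _ q hq hd =>
    ⟨UniformSpace.Completion Y, inferInstance, inferInstance, fun i => (q i : _),
      UniformSpace.Completion.denseRange_coe.comp hq.denseRange
        (UniformSpace.Completion.continuous_coe _),
      fun i j => (UniformSpace.Completion.dist_eq _ _).trans (hd i j)⟩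
  let P : PseudoMetricSpace (ULift.{u} ℕ) :=
    { dist := fun i j => d i.down j.down
      dist_self := fun _ => hself _
      dist_comm := fun _ _ => hcomm _ _
      dist_triangle := fun _ _ _ => htri _ _ _ }
  exact @key (ULift.{u} ℕ) P ULift.up ULift.up_surjective fun _ _ => rfl

namespace MetricStructure

variable {L : FirstOrder.Language.{v, w}} {A B C D M N : MetricStructure.{u} L}
variable {K : Set (MetricStructure.{u} L)}

/-- A generic sequence: a dense sequence `p` in a metric space `X`, together with coherent types of
its finite parts, such that every type over a finite part is approximately realized in the sequence.
The type of `p 0, …, p l` is that of the first members of the sequence `pt l` in the member `str l`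
of `K`. -/
structure GenericSequence (K : Set (MetricStructure.{u} L)) (X : Type u) [MetricSpace X] where
  str : ℕ → MetricStructure.{u} L
  mem : ∀ l, str l ∈ K
  pt : ∀ l, ℕ → str l
  p : ℕ → X
  sameType : ∀ {ι : Type} (σ : ι → ℕ) {l l' : ℕ}, l ≤ l' → (∀ i, σ i ≤ l) →
    SameType (fun i => pt l (σ i)) (fun i => pt l' (σ i))
  dense : DenseRange p
  dist_eq : ∀ {i j l : ℕ}, i ≤ l → j ≤ l → dist (p i) (p j) = dist (pt l i) (pt l j)
  rich : ∀ {ι : Type} [Finite ι] (σ : ι → ℕ) (l : ℕ), (∀ i, σ i ≤ l) →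
    ∀ A : MetricStructure.{u} L, IsStructureOf K A → ∀ (a : ι → A) (y : A) (r r' : ℝ), 0 < r →
      r < r' → Close K (fun i => pt l (σ i)) a r → ∃ i l', l ≤ l' ∧ i ≤ l' ∧
        Close K (Option.elim' (pt l' i) fun i => pt l' (σ i)) (Option.elim' y a) r'

/-- One step of the construction of a generic sequence. -/
theorem exists_generic_step (hp : HP K) (nap : NAP K) (hA : A ∈ K) (p : ℕ → A) {l : ℕ}
    {ι : Type} [Finite ι] (σ : ι → ℕ) (hσ : ∀ i, σ i ≤ l) (hB : IsStructureOf K B) (b : ι → B)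
    (y : B) {r : ℝ} (hr : 0 < r) (h : Close K (fun i => p (σ i)) b r) :
    ∃ A' ∈ K, ∃ p' : ℕ → A', SameType (fun i : Fin (l + 1) => p i) (fun i : Fin (l + 1) => p' i) ∧
      Close K (Option.elim' (p' (l + 1)) fun i => p' (σ i)) (Option.elim' y b) r := by
  obtain ⟨E, hE, a', b', ha, hb, hd⟩ := Close.exists_joint hp nap (hp A hA) hB
    (a := fun i : Fin (l + 1) => p i) (b := Option.elim' y b)
    (fun i => ⟨σ i, Nat.lt_succ_of_le (hσ i)⟩) some h
  let p' : ℕ → E := fun i => if hi : i < l + 1 then a' ⟨i, hi⟩ else b' none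
  have hp' : ∀ i : Fin (l + 1), p' i = a' i := fun i => dif_pos i.2
  refine ⟨E, hE, p', by simpa only [hp'] using ha, E, hE, _, b', .refl _, hb, ?_⟩
  rintro (_ | i)
  · simpa [p'] using hr
  · have := hp' ⟨σ i, Nat.lt_succ_of_le (hσ i)⟩
    simp only [Option.elim'_some, this]
    exact hd i

/-- Generic sequences exist. At stage `l` the sequence has reached the index `l`, and the next point
is chosen so as to meet the requirement whose code is the first component of `l`; thus each
requirement is considered at arbitrarily large stages. -/
theorem IsFraisseClass.exists_genericSequence (hK : IsFraisseClass K) (hA : A ∈ K) (p₀ : A) :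
    ∃ (X : Type u) (_ : MetricSpace X) (_ : CompleteSpace X), Nonempty (GenericSequence K X) := by
  choose D hD hDd using fun n => (hK.pp n).1
  have := fun n => (hD n).to_subtype
  -- The requirements: a type over a finite part, from a countable dense set, and a radius.
  obtain ⟨code, hcode⟩ := Countable.exists_injective_nat
    (Σ n : ℕ, (Fin n → ℕ) × D (n + 1) × ℚ)
  obtain ⟨s, -, hs⟩ := exists_seq_of_forall_exists
    (α := fun _ => Σ A : {A : MetricStructure.{u} L // A ∈ K}, ℕ → A.1) (fun _ _ => True)
    (fun l s s' => SameType (fun i : Fin (l + 1) => s.2 i) (fun i : Fin (l + 1) => s'.2 i) ∧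
      ∀ (n : ℕ) (σ : Fin n → ℕ) (c : D (n + 1)) (r : ℚ), code ⟨n, σ, c, r⟩ = (Nat.unpair l).1 →
        (∀ i, σ i ≤ l) → (0 : ℝ) < r →
        Close K (fun i => s.2 (σ i)) (fun i => c.1.tuple (Fin.castSucc i)) r →
        Close K (Option.elim' (s'.2 (l + 1)) fun i => s'.2 (σ i))
          (Option.elim' (c.1.tuple (Fin.last n)) fun i => c.1.tuple (Fin.castSucc i)) r)
    ⟨⟨⟨A, hA⟩, fun _ => p₀⟩, trivial⟩ (by
      rintro l ⟨⟨B, hB⟩, q⟩ -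
      by_cases h : ∃ (n : ℕ) (σ : Fin n → ℕ) (c : D (n + 1)) (r : ℚ),
          code ⟨n, σ, c, r⟩ = (Nat.unpair l).1 ∧ (∀ i, σ i ≤ l) ∧ (0 : ℝ) < r ∧
          Close K (fun i => q (σ i)) (fun i => c.1.tuple (Fin.castSucc i)) r
      · obtain ⟨n, σ, c, r, hc, hσ, hr, hcl⟩ := h
        obtain ⟨B', hB', q', h1, h2⟩ := exists_generic_step hK.hp hK.nap hB q σ hσ
          (hK.hp _ c.1.mem) _ (c.1.tuple (Fin.last n)) hr hcl
        refine ⟨⟨⟨B', hB'⟩, q'⟩, trivial, h1, fun n' σ' c' r' hc' _ _ _ => ?_⟩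
        have := hcode (hc'.trans hc.symm)
        cases this
        exact h2
      · exact ⟨⟨⟨B, hB⟩, q⟩, trivial, .refl _, fun n σ c r hc hσ hr hcl =>
          (h ⟨n, σ, c, r, hc, hσ, hr, hcl⟩).elim⟩)
  -- Types of finite parts do not depend on the stage, so that distances are well defined.
  have hcoh : ∀ {ι : Type} (σ : ι → ℕ) {l l' : ℕ}, l ≤ l' → (∀ i, σ i ≤ l) →
      SameType (fun i => (s l).2 (σ i)) (fun i => (s l').2 (σ i)) := fun {ι} σ {l l'} hl hσ => by
    induction l', hl using Nat.le_induction with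
    | base => exact .refl _
    | succ m hm ih =>
      exact ih.trans ((hs m).1.comp fun i => ⟨σ i, Nat.lt_succ_of_le ((hσ i).trans hm)⟩)
  have hdist : ∀ {i j l : ℕ}, i ≤ l → j ≤ l →
      dist ((s (max i j)).2 i) ((s (max i j)).2 j) = dist ((s l).2 i) ((s l).2 j) :=
    fun {i j l} hi hj => (hcoh (fun b : Bool => cond b i j) (max_le hi hj)
      (by rintro (_ | _) <;> simp)).dist_eq true false
  obtain ⟨X, hX, hXc, p, hp, hpd⟩ := exists_complete_of_dist.{u}
    (fun i j => dist ((s (max i j)).2 i) ((s (max i j)).2 j)) (fun i => dist_self _)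
    (fun i j => by
      rw [hdist (le_max_left i j) (le_max_right i j), dist_comm,
        ← hdist (le_max_right i j) (le_max_left i j)])
    (fun i j k => by
      have hi : i ≤ max i (max j k) := le_max_left _ _
      have hj : j ≤ max i (max j k) := (le_max_left _ _).trans (le_max_right _ _)
      have hk : k ≤ max i (max j k) := (le_max_right _ _).trans (le_max_right _ _)
      rw [hdist hi hk, hdist hi hj, hdist hj hk]
      exact dist_triangle _ _ _)
  refine ⟨X, hX, hXc, ⟨⟨fun l => (s l).1.1, fun l => (s l).1.2, fun l => (s l).2, p, hcoh, hp,
    fun {i j l} hi hj => by rw [hpd, hdist hi hj], ?_⟩⟩⟩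
  -- An arbitrary type over a finite part is replaced by a nearby one from the countable dense set.
  intro ι _ σ l hσ B hB b y r r' hr hrr' hcl
  obtain ⟨n, ⟨e⟩⟩ := Finite.exists_equiv_fin ι
  have hδ : 0 < (r' - r) / 3 := by linarith
  set δ := (r' - r) / 3 with hδdef
  obtain ⟨c, hcD, hc⟩ := hDd (n + 1)
    (hB.toGenerated (Fin.snoc (α := fun _ => B) (fun i => b (e.symm i)) y)) _
    (ENNReal.ofReal_pos.2 hδ)
  replace hc := ((Generated.distK_lt_ofReal_iff hK.hp hK.nap hδ).1 hc).congr_left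
    (SameType.genTuple_left _).symm
  obtain ⟨ρ, hρ, hρ'⟩ := exists_rat_btwn (show r + δ < r + 2 * δ by linarith)
  have hl := Nat.right_le_pair (code ⟨n, fun i => σ (e.symm i), ⟨c, hcD⟩, ρ⟩) l
  have h1 : Close K (fun i => (s l).2 (σ (e.symm i))) (fun i => c.tuple (Fin.castSucc i)) ρ := by
    have h2 := hc.comp Fin.castSucc
    simp only [Fin.snoc_castSucc] at h2
    exact ((hcl.comp e.symm).trans hK.hp hK.nap (hK.hp _ (s l).1.2) h2).mono hρ.le
  obtain ⟨l₁, hl₁, h2⟩ : ∃ l₁ ≥ l, Close K (Option.elim' ((s (l₁ + 1)).2 (l₁ + 1)) fun i =>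
      (s (l₁ + 1)).2 (σ (e.symm i)))
        (Option.elim' (c.tuple (Fin.last n)) fun i => c.tuple (Fin.castSucc i)) ρ :=
    ⟨_, hl, (hs _).2 n (fun i => σ (e.symm i)) ⟨c, hcD⟩ ρ (by rw [Nat.unpair_pair])
      (fun i => (hσ _).trans hl) (by linarith) (h1.congr_left (hcoh _ hl fun i => hσ _).symm)⟩
  refine ⟨l₁ + 1, l₁ + 1, by omega, le_rfl, ?_⟩
  have h3 := h2.comp (Option.map e)
  have h4 := hc.symm.comp fun o : Option ι => Option.elim' (Fin.last n) (fun i => (e i).castSucc) o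
  have h5 : Close K (Option.elim' ((s (l₁ + 1)).2 (l₁ + 1)) fun i => (s (l₁ + 1)).2 (σ i))
      (fun o : Option ι => c.tuple
        (Option.elim' (Fin.last n) (fun i => (e i).castSucc) o)) ρ := by
    convert h3 using 1 <;> ext (_ | i) <;> simp
  have h6 : Close K (fun o : Option ι => c.tuple
        (Option.elim' (Fin.last n) (fun i => (e i).castSucc) o)) (Option.elim' y b) δ := by
    convert h4 using 1
    ext (_ | i)
    · exact (Fin.snoc_last (α := fun _ => B) _ _).symm
    · simp [Fin.snoc_castSucc]
  exact (h5.trans hK.hp hK.nap (hK.hp _ (s _).1.2) h6).mono (by linarith)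

theorem SameType.func_eq {ι : Type*} {a : ι → A} {b : ι → B} (h : SameType a b) {n : ℕ}
    (f : L.Functions n) (σ : Fin n → ι) {k : ι} (hk : a k = A.func f fun i => a (σ i)) :
    b k = B.func f fun i => b (σ i) := by
  obtain ⟨D, d, g, g', hg, hg'⟩ := h
  have hd : d k = D.func f fun i => d (σ i) := by
    apply g.isometry.injective
    rw [← g.map_func, hg, hk]
    exact congrArg _ (funext fun i => (hg _).symm)
  rw [← hg', hd, ← g'.map_func]
  exact congrArg _ (funext fun i => hg' _)

namespace GenericSequence

variable {X : Type u} [MetricSpace X] (T : GenericSequence K X) {ι κ : Type}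

/-- The family `x` of points of `X` is within `r` of a finite part of the generic sequence whose
type is `r`-close to that of `a`. -/
def Near (x : ι → X) (a : ι → A) (r : ℝ) : Prop :=
  ∃ (σ : ι → ℕ) (l : ℕ), (∀ i, σ i ≤ l) ∧ (∀ i, dist (x i) (T.p (σ i)) < r) ∧
    Close K (fun i => T.pt l (σ i)) a r

/-- The family `x` of points of `X` has the type of the family `a`. -/
def HasType (x : ι → X) (a : ι → A) : Prop := ∀ r > 0, T.Near x a r

variable {T} {x x' : ι → X} {a : ι → A} {b : ι → B} {r s : ℝ}

theorem Near.mono (h : T.Near x a r) (hrs : r ≤ s) : T.Near x a s :=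
  let ⟨σ, l, hσ, hd, hc⟩ := h
  ⟨σ, l, hσ, fun i => (hd i).trans_le hrs, hc.mono hrs⟩

theorem Near.comp (h : T.Near x a r) (ρ : κ → ι) :
    T.Near (fun k => x (ρ k)) (fun k => a (ρ k)) r :=
  let ⟨σ, l, hσ, hd, hc⟩ := h
  ⟨fun k => σ (ρ k), l, fun _ => hσ _, fun _ => hd _, hc.comp ρ⟩

theorem Near.trans_close [Finite ι] (hK : IsFraisseClass K) (h : T.Near x a r)
    (hab : Close K a b s) (hs : 0 < s) : T.Near x b (r + s) :=
  let ⟨σ, l, hσ, hd, hc⟩ := h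
  ⟨σ, l, hσ, fun i => (hd i).trans (by linarith),
    hc.trans hK.hp hK.nap (hK.hp _ (T.mem l)) hab⟩

theorem Near.of_dist_lt (h : T.Near x a r) (hxx : ∀ i, dist (x' i) (x i) < s) (hs : 0 < s) :
    T.Near x' a (r + s) :=
  let ⟨σ, l, hσ, hd, hc⟩ := h
  ⟨σ, l, hσ, fun i => by linarith [dist_triangle (x' i) (x i) (T.p (σ i)), hxx i, hd i],
    hc.mono (by linarith)⟩

theorem Near.close [Finite ι] (hK : IsFraisseClass K) (hA : IsStructureOf K A)
    (h : T.Near x a r) {r' : ℝ} (h' : T.Near x' b r') (hd : ∀ i, dist (x i) (x' i) < s) :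
    Close K a b (2 * r + 2 * r' + s) := by
  obtain ⟨σ, l, hσ, hxσ, hc⟩ := h
  obtain ⟨σ', l', hσ', hxσ', hc'⟩ := h'
  have h1 := hc.congr_left (T.sameType σ (le_max_left l l') hσ).symm
  have h2 := hc'.congr_left (T.sameType σ' (le_max_right l l') hσ').symm
  have h3 : Close K (fun i => T.pt (max l l') (σ i)) (fun i => T.pt (max l l') (σ' i))
      (r + s + r') := by
    refine Close.of_dist_lt (hK.hp _ (T.mem _)) fun i => ?_
    rw [← T.dist_eq ((hσ i).trans (le_max_left l l')) ((hσ' i).trans (le_max_right l l'))]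
    have := dist_triangle4 (T.p (σ i)) (x i) (x' i) (T.p (σ' i))
    rw [dist_comm _ (x i)] at this
    linarith [hxσ i, hxσ' i, hd i]
  exact ((h1.symm.trans hK.hp hK.nap hA h3).trans hK.hp hK.nap hA h2).mono (by linarith)

theorem Near.extend [Finite ι] (hA : IsStructureOf K A) (h : T.Near x a r) (hr : 0 < r)
    (hrs : r < s) (y : A) : ∃ z, T.Near (Option.elim' z x) (Option.elim' y a) s := by
  obtain ⟨σ, l, hσ, hd, hc⟩ := h
  obtain ⟨i, l', hl, hi, hc'⟩ := T.rich σ l hσ A hA a y r s hr hrs hc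
  refine ⟨T.p i, Option.elim' i σ, l', ?_, ?_, ?_⟩
  · rintro (_ | j)
    exacts [hi, (hσ j).trans hl]
  · rintro (_ | j)
    · simpa using hr.trans hrs
    · exact (hd j).trans hrs
  · convert hc' using 1
    ext (_ | j) <;> rfl

variable (T) in
theorem exists_near [Finite ι] (hK : IsFraisseClass K) (x : ι → X) (hr : 0 < r) :
    ∃ (l : ℕ) (a : ι → T.str l), T.Near x a r := by
  choose σ hσ using fun i => Metric.denseRange_iff.1 T.dense (x i) r hr
  obtain ⟨l, hl⟩ := (Set.finite_range σ).bddAbove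
  exact ⟨l, fun i => T.pt l (σ i), σ, l, fun i => hl ⟨i, rfl⟩, hσ,
    Close.of_sameType (hK.hp _ (T.mem l)) (.refl _) hr⟩

/-- Over a tuple of type `a`, the points that have approximately the type of a point of the
structure generated by `a` are close to each other. -/
theorem exists_dist_lt_of_near [Finite ι] (hK : IsFraisseClass K) (hA : IsStructureOf K A)
    (ha : A.span (Set.range a) = Set.univ) (y : A) {ε : ℝ} (hε : 0 < ε) :
    ∃ δ > 0, ∀ (x : ι → X) (z z' : X), T.Near (Option.elim' z x) (Option.elim' y a) δ →
      T.Near (Option.elim' z' x) (Option.elim' y a) δ → dist z z' < ε := by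
  obtain ⟨δ₀, hδ₀, hctrl⟩ := Controlled.self hK hA ha y (ε / 2) (half_pos hε)
  have hδ : 0 < min (δ₀ / 4) (ε / 8) := lt_min (by positivity) (by positivity)
  refine ⟨_, hδ, fun x z z' h h' => ?_⟩
  have hδ₁ := min_le_left (δ₀ / 4) (ε / 8)
  have hδ₂ := min_le_right (δ₀ / 4) (ε / 8)
  set δ := min (δ₀ / 4) (ε / 8)
  obtain ⟨σ, l, hσ, hxσ, hc⟩ := h
  obtain ⟨σ', l', hσ', hxσ', hc'⟩ := h'
  have h1 := hc.congr_left (T.sameType σ (le_max_left l l') hσ).symm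
  have h2 := hc'.congr_left (T.sameType σ' (le_max_right l l') hσ').symm
  -- Two copies of `(y, a)` are put next to the two finite parts of the generic sequence.
  obtain ⟨E, hE, q, c, hq, hcq, hd⟩ := Close.exists_joint hK.hp hK.nap (hK.hp _ (T.mem (max l l')))
    hA (a := Sum.elim (fun i => T.pt (max l l') (σ i)) fun i => T.pt (max l l') (σ' i))
    Sum.inl id h1
  obtain ⟨F, hF, q', c', hq', hcq', hd'⟩ := Close.exists_joint hK.hp hK.nap (hK.hp E hE)
    hA (a := Sum.elim q c) (fun i => .inl (.inr i)) id (h2.congr_left (hq.comp Sum.inr).symm)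
  have hcF : SameType (Option.elim' y a) fun i => q' (.inr i) := hcq.trans (hq'.comp Sum.inr)
  have hspan : A.span (Set.range (Option.elim' y a)) = Set.univ :=
    SameType.span_eq_univ_of_extends ha some fun _ => rfl
  obtain ⟨g, hg⟩ := hcF.exists_embedding hspan
  obtain ⟨k, hk⟩ := hcq'.exists_embedding hspan
  have hqd : ∀ i, dist (q' (.inl (.inl i))) (q' (.inl (.inr i))) =
      dist (T.p (σ i)) (T.p (σ' i)) := fun i => by
    rw [T.dist_eq ((hσ i).trans (le_max_left l l')) ((hσ' i).trans (le_max_right l l'))]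
    exact ((hq.dist_eq (.inl i) (.inr i)).trans (hq'.dist_eq (.inl (.inl i)) (.inl (.inr i)))).symm
  have hdq : ∀ i, dist (q' (.inl (.inl i))) (q' (.inr i)) < δ := fun i => by
    have h3 : dist (q (.inl i)) (c i) = dist (q' (.inl (.inl i))) (q' (.inr i)) :=
      hq'.dist_eq (.inl (.inl i)) (.inr i)
    exact h3 ▸ hd i
  have hclose := hctrl F hF g k fun i => by
    have e1 := hg (some i)
    have e2 := hk (some i)
    simp only [Option.elim'_some] at e1 e2
    rw [e1, e2]
    have h3 := dist_triangle4 (q' (.inr (some i))) (q' (.inl (.inl (some i))))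
      (q' (.inl (.inr (some i)))) (c' (some i))
    have h4 := hdq (some i)
    have h5 := hd' (some i)
    have h6 := hxσ (some i)
    have h7 := hxσ' (some i)
    have h8 := dist_triangle_left (T.p (σ (some i))) (T.p (σ' (some i))) (x i)
    rw [dist_comm (q' (.inr (some i))) (q' (.inl (.inl (some i)))), hqd] at h3
    simp only [Option.elim'_some, id] at h5 h6 h7
    linarith
  have e1 := hg none
  have e2 := hk none
  simp only [Option.elim'_none] at e1 e2
  rw [e1, e2] at hclose
  have h3 := dist_triangle4 (q' (.inl (.inl none))) (q' (.inr none)) (c' none)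
    (q' (.inl (.inr none)))
  have h4 := hdq none
  have h5 := hd' none
  have h6 := hxσ none
  have h7 := hxσ' none
  have h8 := dist_triangle4 z (T.p (σ none)) (T.p (σ' none)) z'
  rw [dist_comm (c' none), hqd] at h3
  simp only [Option.elim'_none, id] at h5 h6 h7
  rw [dist_comm (T.p (σ' none))] at h8
  linarith

/-! ### The types of tuples in the completion -/

theorem HasType.comp (h : T.HasType x a) (ρ : κ → ι) :
    T.HasType (fun k => x (ρ k)) (fun k => a (ρ k)) :=
  fun r hr => (h r hr).comp ρ

theorem HasType.close [Finite ι] (hK : IsFraisseClass K) (hA : IsStructureOf K A)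
    (h : T.HasType x a) (h' : T.HasType x' b) (hd : ∀ i, dist (x i) (x' i) < s) :
    Close K a b s := by
  obtain ⟨s', hs', hd⟩ := exists_lt_of_forall_lt hd
  have hr : 0 < (s - s') / 4 := by linarith
  exact ((h _ hr).close hK hA (h' _ hr) hd).mono (by linarith)

theorem HasType.sameType [Finite ι] (hK : IsFraisseClass K) (hA : IsStructureOf K A)
    (hB : IsStructureOf K B) (h : T.HasType x a) (h' : T.HasType x b) : SameType a b :=
  hK.sameType_of_close hA hB fun r hr => h.close hK hA h' fun i => by simpa using hr

theorem HasType.congr [Finite ι] (hK : IsFraisseClass K) (hA : IsStructureOf K A)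
    (h : T.HasType x a) (hab : SameType a b) : T.HasType x b := fun r hr => by
  have := (h _ (half_pos hr)).trans_close hK (Close.of_sameType hA hab (half_pos hr)) (half_pos hr)
  rwa [add_halves] at this

theorem HasType.dist_eq (h : T.HasType x a) (i j : ι) : dist (x i) (x j) = dist (a i) (a j) := by
  refine eq_of_forall_dist_le fun ε hε => ?_
  obtain ⟨σ, l, hσ, hd, hc⟩ := h (ε / 4) (by positivity)
  have h1 := hc.dist_lt i j
  have h2 := hc.symm.dist_lt i j
  rw [← T.dist_eq (hσ i) (hσ j)] at h1 h2
  have h3 := abs_le.1 (dist_dist_dist_le (x i) (x j) (T.p (σ i)) (T.p (σ j)))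
  rw [Real.dist_eq, abs_le]
  constructor <;> linarith [hd i, hd j, h3.1, h3.2]

theorem HasType.of_forall_near (h : ∀ r > 0, ∃ x', T.Near x' a r ∧ ∀ i, dist (x i) (x' i) < r) :
    T.HasType x a := fun r hr => by
  obtain ⟨x', h1, h2⟩ := h (r / 2) (half_pos hr)
  have := h1.of_dist_lt h2 (half_pos hr)
  rwa [add_halves] at this

variable (T) in
/-- Every tuple of the completion has a type, by completeness of the spaces of types. -/
theorem exists_hasType [Finite ι] (hK : IsFraisseClass K) (x : ι → X) :
    ∃ A ∈ K, ∃ a : ι → A, A.span (Set.range a) = Set.univ ∧ T.HasType x a := by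
  obtain ⟨n, ⟨e⟩⟩ := Finite.exists_equiv_fin ι
  have hpos : ∀ k : ℕ, (0 : ℝ) < (1 / 2) ^ k := fun k => by positivity
  have hlim := tendsto_pow_atTop_nhds_zero_of_lt_one (by norm_num : (0 : ℝ) ≤ 1 / 2) (by norm_num)
  choose l a ha using fun k : ℕ => T.exists_near hK (fun i => x (e.symm i)) (hpos k)
  let s : ℕ → Generated K n := fun k => (hK.hp _ (T.mem (l k))).toGenerated (a k)
  have hs : ∀ k, SameType (s k).tuple (a k) := fun k => SameType.genTuple_left (a k)
  obtain ⟨c, hc⟩ := (hK.pp n).2 s fun ε hε => by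
    obtain ⟨r, hr, hrε⟩ := exists_ofReal_le hε
    obtain ⟨N, hN⟩ :=
      (hlim.eventually_lt_const (show 0 < r / 5 by positivity)).exists_forall_of_atTop
    refine ⟨N, fun i hi j hj => lt_of_lt_of_le
      ((Generated.distK_lt_ofReal_iff hK.hp hK.nap hr).2 ?_) hrε⟩
    have h1 := (ha i).close hK (hK.hp _ (T.mem _)) (ha j) (s := r / 5)
      fun i => by simpa using by positivity
    exact ((h1.mono (by linarith [hN i hi, hN j hj])).congr_left (hs i)).congr_right (hs j).symm
  refine ⟨c.str, c.mem, fun i => c.tuple (e i), ?_, fun r hr => ?_⟩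
  · exact SameType.span_eq_univ_of_extends c.span_eq e.symm fun i => by simp
  · obtain ⟨N, hN⟩ := hc _ (ENNReal.ofReal_pos.2 (half_pos hr))
    obtain ⟨k, hk, hkN⟩ := ((hlim.eventually_lt_const (half_pos hr)).and
      (Filter.eventually_ge_atTop N)).exists
    have h1 := (Generated.distK_lt_ofReal_iff hK.hp hK.nap (half_pos hr)).1 (hN k hkN)
    have h2 := (((ha k).mono hk.le).trans_close hK (h1.congr_left (hs k).symm) (half_pos hr)).comp e
    simpa using h2

/-- If `x` has the type of a family that generates `A`, then each point of `A` determines a point of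
the completion: the approximate realizations provided by genericity converge. -/
theorem HasType.exists_extend [Finite ι] [CompleteSpace X] (hK : IsFraisseClass K)
    (hA : IsStructureOf K A) (ha : A.span (Set.range a) = Set.univ) (h : T.HasType x a) (y : A) :
    ∃ z, T.HasType (Option.elim' z x) (Option.elim' y a) := by
  have hpos : ∀ k : ℕ, (0 : ℝ) < (1 / 2) ^ k := fun k => by positivity
  have hlim := tendsto_pow_atTop_nhds_zero_of_lt_one (by norm_num : (0 : ℝ) ≤ 1 / 2) (by norm_num)
  choose z hz using fun k : ℕ => (h _ (half_pos (hpos k))).extend hA (half_pos (hpos k))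
    (half_lt_self (hpos k)) y
  have hcau : CauchySeq z := by
    refine Metric.cauchySeq_iff.2 fun ε hε => ?_
    obtain ⟨δ, hδ, huniq⟩ := exists_dist_lt_of_near (T := T) hK hA ha y hε
    obtain ⟨N, hN⟩ := (hlim.eventually_lt_const hδ).exists_forall_of_atTop
    exact ⟨N, fun m hm n hn => huniq x _ _ ((hz m).mono (hN m hm).le) ((hz n).mono (hN n hn).le)⟩
  obtain ⟨t, ht⟩ := cauchySeq_tendsto_of_complete hcau
  refine ⟨t, HasType.of_forall_near fun r hr => ?_⟩
  obtain ⟨k, hk, hkt⟩ := ((hlim.eventually_lt_const hr).and (Metric.tendsto_nhds.1 ht r hr)).exists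
  refine ⟨_, (hz k).mono hk.le, ?_⟩
  rintro (_ | i)
  · rw [dist_comm]; exact hkt
  · simpa using hr

/-! ### The structure on the completion -/

section Model

variable (hK : IsFraisseClass K)

/-- The value of a predicate symbol is read off the type of the arguments. -/
noncomputable def pred (T : GenericSequence K X) (hK : IsFraisseClass K) {n : ℕ}
    (R : L.Relations n) (x : Fin n → X) : ℝ :=
  (T.exists_hasType hK x).choose.pred R (T.exists_hasType hK x).choose_spec.2.choose

theorem HasType.pred_eq [Finite ι] (hA : IsStructureOf K A) (h : T.HasType x a) {n : ℕ}
    (R : L.Relations n) (σ : Fin n → ι) :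
    T.pred hK R (fun i => x (σ i)) = A.pred R fun i => a (σ i) := by
  have h1 := (T.exists_hasType hK fun i => x (σ i)).choose_spec
  exact (h1.2.choose_spec.2.sameType hK (hK.hp _ h1.1) hA (h.comp σ)).pred_eq R id

theorem continuous_pred (T : GenericSequence K X) {n : ℕ} (R : L.Relations n) :
    Continuous (T.pred hK R) := by
  refine Metric.continuous_iff.2 fun x ε hε => ?_
  obtain ⟨A, hA, a, -, ha⟩ := T.exists_hasType hK x
  obtain ⟨δ, hδ, h⟩ := hK.exists_pred_close (hK.hp A hA) R a hε
  refine ⟨δ, hδ, fun x' hx' => ?_⟩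
  obtain ⟨B, hB, b, -, hb⟩ := T.exists_hasType hK x'
  have h1 := h B (hK.hp B hB) b (ha.close hK (hK.hp A hA) hb
    ((dist_pi_lt_iff hδ).1 (dist_comm x x' ▸ hx')))
  have h2 : T.pred hK R x = A.pred R a := ha.pred_eq hK (hK.hp A hA) R id
  have h3 : T.pred hK R x' = B.pred R b := hb.pred_eq hK (hK.hp B hB) R id
  rw [h2, h3, Real.dist_eq, abs_sub_comm]
  exact h1

variable [CompleteSpace X]

theorem exists_func (T : GenericSequence K X) (hK : IsFraisseClass K) {n : ℕ}
    (f : L.Functions n) (x : Fin n → X) : ∃ (z : X), ∃ A ∈ K, ∃ a : Fin n → A,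
      T.HasType (Option.elim' z x) (Option.elim' (A.func f a) a) := by
  obtain ⟨A, hA, a, ha, hx⟩ := T.exists_hasType hK x
  obtain ⟨z, hz⟩ := hx.exists_extend hK (hK.hp A hA) ha (A.func f a)
  exact ⟨z, A, hA, a, hz⟩

/-- The value of a function symbol is the point whose type over the arguments is that of the value
of the symbol in a structure that realizes the type of the arguments. -/
noncomputable def func (T : GenericSequence K X) (hK : IsFraisseClass K) {n : ℕ}
    (f : L.Functions n) (x : Fin n → X) : X :=
  (T.exists_func hK f x).choose

theorem HasType.adjoin_func [Finite ι] (hA : IsStructureOf K A) (h : T.HasType x a) {n : ℕ}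
    (f : L.Functions n) (σ : Fin n → ι) :
    T.HasType (Option.elim' (T.func hK f fun i => x (σ i)) x)
      (Option.elim' (A.func f fun i => a (σ i)) a) := by
  obtain ⟨B, hB, b, -, hb⟩ := T.exists_hasType hK
    (Option.elim' (T.func hK f fun i => x (σ i)) x)
  have hBs := hK.hp B hB
  obtain ⟨C, hC, c, hc⟩ := (T.exists_func hK f fun i => x (σ i)).choose_spec
  have h1 : SameType (fun i => b (some i)) a := (hb.comp some).sameType hK hBs hA h
  have h2 : SameType (Option.elim' (C.func f c) c)
      (Option.elim' (b none) fun i => b (some (σ i))) := by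
    refine hc.sameType hK (hK.hp C hC) hBs ?_
    convert hb.comp (Option.elim' none fun i => some (σ i)) using 1 <;> ext (_ | i) <;> rfl
  have h3 : b none = B.func f fun i => b (some (σ i)) := h2.func_eq f some (k := none) rfl
  refine hb.congr hK hBs ?_
  convert h1.adjoin_func f σ using 1
  ext (_ | i)
  exacts [h3, rfl]

theorem HasType.func_eq [Finite ι] (hA : IsStructureOf K A) (h : T.HasType x a) {n : ℕ}
    (f : L.Functions n) (σ : Fin n → ι) {k : ι} (hk : a k = A.func f fun i => a (σ i)) :
    x k = T.func hK f fun i => x (σ i) := by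
  have h1 := (h.adjoin_func hK hA f σ).dist_eq (some k) none
  simp only [Option.elim'_some, Option.elim'_none, hk, dist_self] at h1
  exact dist_eq_zero.1 h1

theorem continuous_func (T : GenericSequence K X) {n : ℕ} (f : L.Functions n) :
    Continuous (T.func hK f) := by
  refine Metric.continuous_iff.2 fun x ε hε => ?_
  obtain ⟨A, hA, a, -, ha⟩ := T.exists_hasType hK x
  obtain ⟨δ, hδ, h⟩ := hK.exists_func_close (hK.hp A hA) f a hε
  refine ⟨δ, hδ, fun x' hx' => ?_⟩
  -- In a joint type of `x` and `x'`, the uniform modulus of `f` at `a` applies.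
  obtain ⟨B, hB, b, -, hb⟩ := T.exists_hasType hK (Sum.elim x x')
  have hBs := hK.hp B hB
  have h1 : SameType a fun i => b (.inl i) := ha.sameType hK (hK.hp A hA) hBs (hb.comp Sum.inl)
  have h2 := h B hBs (fun i => b (.inl i)) (fun i => b (.inr i))
    (Close.of_sameType (hK.hp A hA) h1 hδ) fun i => by
      rw [← hb.dist_eq (.inl i) (.inr i), dist_comm]
      exact (dist_pi_lt_iff hδ).1 hx' i
  have h3 := (hb.adjoin_func hK hBs f Sum.inl).adjoin_func hK hBs f fun i => some (.inr i)
  have h4 := h3.dist_eq none (some none)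
  rw [dist_comm (B.func f _)] at h2
  exact h4.trans_lt h2

/-- The completion of a generic sequence, as a structure. -/
noncomputable def toStructure (T : GenericSequence K X) (hK : IsFraisseClass K) :
    MetricStructure.{u} L where
  carrier := X
  pred R := T.pred hK R
  func f := T.func hK f
  continuous_pred R := T.continuous_pred hK R
  continuous_func f := T.continuous_func hK f

/-- If `x` has the type of a family that generates `A`, then `A` embeds in the completion over
`x`. -/
theorem HasType.exists_embedding [Finite ι] (hA : IsStructureOf K A)
    (ha : A.span (Set.range a) = Set.univ) (h : T.HasType x a) :
    ∃ e : Embedding A (T.toStructure hK), ∀ i, e (a i) = x i := by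
  choose e he using fun y => h.exists_extend hK hA ha y
  -- A joint type of `x` and of finitely many values `e (y k)` is that of `a` and `y`: the embedding
  -- of `A` that maps `a` to the first part is forced to map `y` to the second one.
  have joint : ∀ {κ : Type} [Finite κ] (y : κ → A),
      T.HasType (Sum.elim x fun k => e (y k)) (Sum.elim a y) := fun {κ} _ y => by
    obtain ⟨B, hB, b, -, hb⟩ := T.exists_hasType hK (Sum.elim x fun k => e (y k))
    have hBs := hK.hp B hB
    obtain ⟨g, hg⟩ := (h.sameType hK hA hBs (hb.comp Sum.inl)).exists_embedding ha
    have hgy : ∀ k, g (y k) = b (.inr k) := fun k => by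
      have h1 : SameType (Option.elim' (y k) a)
          (Option.elim' (b (.inr k)) fun i => b (.inl i)) := by
        refine (he (y k)).sameType hK hA hBs ?_
        convert hb.comp (Option.elim' (.inr k) Sum.inl) using 1 <;> ext (_ | i) <;> rfl
      obtain ⟨g', hg'⟩ := h1.exists_embedding
        (SameType.span_eq_univ_of_extends ha some fun _ => rfl)
      rw [g.eq_of_eqOn g' ha (by rintro _ ⟨i, rfl⟩; exact (hg i).trans (hg' (some i)).symm)]
      exact hg' none
    refine hb.congr hK hBs ?_
    convert (SameType.of_embedding g (Sum.elim a y)).symm using 1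
    ext (i | k)
    exacts [(hg i).symm, (hgy k).symm]
  refine ⟨⟨e, .of_dist_eq fun y y' => ?_, fun R y => ?_, fun f y => ?_⟩, fun i => ?_⟩
  · exact (joint fun b : Bool => cond b y y').dist_eq (.inr true) (.inr false)
  · exact (joint y).pred_eq hK hA R Sum.inr
  · exact ((joint (Option.elim' (A.func f y) y)).func_eq hK hA f (fun i => .inr (some i))
      (k := .inr none) rfl).symm
  · refine dist_eq_zero.1 (((joint fun _ : Unit => a i).dist_eq (.inr ()) (.inl i)).trans ?_)
    exact dist_self _

theorem isStructureOf_toStructure (T : GenericSequence K X) (hK : IsFraisseClass K) :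
    IsStructureOf K (T.toStructure hK) := by
  rintro B ⟨⟨S, hS, hSu⟩, ⟨k⟩⟩
  have := hS.to_subtype
  obtain ⟨n, ⟨e⟩⟩ := Finite.exists_equiv_fin S
  obtain ⟨A, hA, a, ha, h⟩ := T.exists_hasType hK fun i => k (e.symm i : B)
  obtain ⟨g, hg⟩ := h.exists_embedding hK (hK.hp A hA) ha
  obtain ⟨l, -⟩ := g.exists_lift k fun y => k.mem_of_span_eq_univ hSu g.isSubstructure_range
    (fun s hs => ⟨a (e ⟨s, hs⟩), by rw [hg, e.symm_apply_apply]⟩) y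
  exact hK.hp A hA ⟨⟨S, hS, hSu⟩, ⟨l⟩⟩

theorem rich_toStructure (T : GenericSequence K X) (hK : IsFraisseClass K) :
    Rich K (T.toStructure hK) := by
  intro ι _ x C hC c y hxc ε hε
  obtain ⟨A, hA, a, ha, hx⟩ := T.exists_hasType hK (x : ι → X)
  obtain ⟨g, hg⟩ := hx.exists_embedding hK (hK.hp A hA) ha
  have hax : SameType a x := by
    convert SameType.of_embedding g a using 1
    exact funext fun i => (hg i).symm
  have hxc' : T.HasType (x : ι → X) c := hx.congr hK (hK.hp A hA) (hax.trans hxc)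
  obtain ⟨z, hz⟩ := (hxc' (ε / 6) (by positivity)).extend (hK.hp C hC) (by positivity)
    (show ε / 6 < ε / 5 by linarith) y
  obtain ⟨B, hB, b, hb, hxb⟩ := T.exists_hasType hK (Option.elim' z (x : ι → X))
  obtain ⟨k, hk⟩ := hxb.exists_embedding hK (hK.hp B hB) hb
  have h1 := (hxb (ε / 5) (by positivity)).close hK (hK.hp B hB) hz (s := ε / 5)
    fun i => by simpa using by positivity
  refine ⟨z, (h1.mono (by linarith)).congr_left ?_⟩
  refine SameType.symm ?_
  convert SameType.of_embedding k b using 1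
  exact funext fun i => (hk i).symm

end Model

end GenericSequence

/-! ### The correspondence -/

theorem IsFraisseClass.exists_ultrahomogeneous (hK : IsFraisseClass K) (hne : K.Nonempty) :
    ∃ M : MetricStructure.{u} L, M.IsApproximatelyUltrahomogeneous ∧ M.age = K := by
  by_cases h : ∃ A ∈ K, Nonempty A
  · obtain ⟨A, hA, ⟨p⟩⟩ := h
    obtain ⟨X, _, _, ⟨T⟩⟩ := hK.exists_genericSequence hA p
    have hs : TopologicalSpace.SeparableSpace (T.toStructure hK) :=
      ⟨Set.range T.p, Set.countable_range _, T.dense⟩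
    have hM := T.isStructureOf_toStructure hK
    have hr := T.rich_toStructure hK
    exact ⟨_, hK.isApproximatelyUltrahomogeneous hM hr, hK.age_eq hM hr⟩
  -- If all members of the class are empty, then each of them is the required structure.
  · push Not at h
    obtain ⟨A, hA⟩ := hne
    have := h A hA
    refine ⟨A, ⟨inferInstance, fun φ ε hε => ⟨⟨.refl A, Function.surjective_id⟩,
      fun a => isEmptyElim (a : A)⟩⟩, Set.Subset.antisymm (hK.hp A hA) fun B hB => ?_⟩
    have := h B hB
    exact ⟨hK.finitelyGenerated B hB, hK.exists_embedding_of_isEmpty (hK.hp A hA) (hK.hp B hB)⟩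

end MetricStructure

theorem mainTheorem1 {L : FirstOrder.Language.{v, w}} (K : Set (MetricStructure.{u} L))
    (hK : ∀ A ∈ K, A.FinitelyGenerated) (hne : K.Nonempty) :
    (MetricStructure.IsFraisseClass K ↔
      ∃ M : MetricStructure.{u} L, M.IsApproximatelyUltrahomogeneous ∧ M.age = K) ∧
    ∀ M : MetricStructure.{u} L, M.IsApproximatelyUltrahomogeneous → M.age = K →
      MetricStructure.IsFraisseLimit K M ∧
      (∀ N : MetricStructure.{u} L, N.IsApproximatelyUltrahomogeneous → N.age = K →
        Nonempty (MetricStructure.Isomorphism M N)) ∧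
      (∀ N : MetricStructure.{u} L, MetricStructure.IsFraisseLimit K N →
        Nonempty (MetricStructure.Isomorphism M N)) ∧
      ∀ N : MetricStructure.{u} L, TopologicalSpace.SeparableSpace N →
        MetricStructure.IsStructureOf K N → Nonempty (MetricStructure.Embedding N M) := by
  refine ⟨⟨fun h => h.exists_ultrahomogeneous hne, ?_⟩, ?_⟩
  · rintro ⟨M, hM, rfl⟩
    exact hM.isFraisseClass_age
  · rintro M hM rfl
    have hF := hM.isFraisseClass_age
    have hlim := hM.isFraisseLimit
    have hrich := hlim.rich hF.hp hF.nap
    have unique : ∀ N : MetricStructure.{u} L, MetricStructure.IsFraisseLimit M.age N →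
        Nonempty (MetricStructure.Isomorphism M N) := fun N hN => by
      have := hM.1
      have := hN.1
      exact hF.nonempty_isomorphism hlim.2.1 hN.2.1 hrich (hN.rich hF.hp hF.nap)
    exact ⟨hlim, fun N hN hage => unique N (hage ▸ hN.isFraisseLimit), unique,
      fun N _ hN => hF.nonempty_embedding hlim.2.1 hN hrich⟩
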